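/- Let $\overline{\mathbb Q}\subset\mathbb C$ be the field of algebraic numbers and $\Gamma=\mathrm{Gal}(\overline{\mathbb Q}/\mathbb Q)$. A (clean) Belyi polynomial is a polynomial $f$ of degree at least $3$ whose critical values in $\mathbb C$ lie in $\{0,1\}$ and whose local degree at every point of $f^{-1}(1)$ is exactly $2$. It is extra-clean dynamical if moreover its postcritical set $\overline{\bigcup_{n>0} f^{\circ n}(\{c\in\mathbb C : f'(c)=0\})}$ is contained in $\{0,1\}$, $f(0)=f(1)=0$, and $f$ has local degree $1$ at $0$ and at $1$. The dessin $\mathbf D_f$ is the planar tree $f^{-1}([0,1])$, with black vertices $f^{-1}(0)$, white vertices $f^{-1}(1)$, and open edges the connected components of $f^{-1}((0,1))$. Two dessins are isomorphic, $\mathbf D_f\simeq\mathbf D_g$, if there are bijections between their black vertices, white vertices and edges that preserve incidence and the counterclockwise cyclic order of the edges around each vertex. Let $BP$ (resp. $XDBP$) be the set of clean Belyi polynomials (resp. extra-clean dynamical Belyi polynomials) in $\overline{\mathbb Q}[z]$. Let $[BP]$ be the set of isomorphism classes $[f]$ of elements of $BP$, where $f,g$ are isomorphic if $f=g\circ A$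 for some affine map $A(z)=az+b$ with $a,b\in\mathbb C$, $a\ne 0$. The group $\Gamma$ acts on $BP$ and on $XDBP$ by acting on coefficients, and this induces an action on $[BP]$. **Theorem.** (1) If $f,g\in\mathbb C[z]$ are extra-clean dynamical Belyi polynomials, then so is $f\circ g$; in particular $XDBP$ is closed under composition. (2) If $f,g\in\mathbb C[z]$ are extra-clean dynamical Belyi polynomials (in particular, if $f,g\in XDBP$), then $$\mathbf D_{f\circ f}\simeq\mathbf D_{g\circ g}\iff f=g.$$ (3) The map $XDBP\to[BP]$, $f\mapsto[f\circ f]$, is injective and $\Gamma$-equivariant. -/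

import Mathlib

namespace BelyiDessin

open Polynomial Topology Filter

/-! ### Complex polynomials as branched covers and as dynamical systems -/

/-- The local degree (ramification index) of the polynomial map `f` at `z`. -/
noncomputable def localDegree (f : ℂ[X]) (z : ℂ) : ℕ :=
  (f - C (f.eval z)).rootMultiplicity z

/-- The set of critical points in the plane. -/
def criticalPoints (f : ℂ[X]) : Set ℂ := {c | f.derivative.eval c = 0}

/-- The set of finite critical values. -/
def criticalValues (f : ℂ[X]) : Set ℂ := (fun z => f.eval z) '' criticalPoints f

/-- The closure of the union of all forward images `f^n (C_f)`, `n > 0`. -/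
def postcriticalSet (f : ℂ[X]) : Set ℂ :=
  closure (⋃ (n : ℕ) (_ : 0 < n), (fun z => f.eval z)^[n] '' criticalPoints f)

/-- A clean Belyi polynomial (of degree at least three): the critical values lie in `{0, 1}`
and the ramification at every point over `1` is exactly two. -/
structure IsBelyi (f : ℂ[X]) : Prop where
  three_le_natDegree : 3 ≤ f.natDegree
  criticalValues_subset : criticalValues f ⊆ {0, 1}
  clean : ∀ z : ℂ, f.eval z = 1 → localDegree f z = 2

/-- A dynamical Belyi polynomial. -/
structure IsDynamicalBelyi (f : ℂ[X]) : Prop extends IsBelyi f where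
  postcriticalSet_subset : postcriticalSet f ⊆ {0, 1}

/-- An extra-clean dynamical Belyi polynomial. -/
structure IsExtraClean (f : ℂ[X]) : Prop extends IsDynamicalBelyi f where
  eval_zero : f.eval 0 = 0
  eval_one : f.eval 1 = 0
  localDegree_zero : localDegree f 0 = 1
  localDegree_one : localDegree f 1 = 1

/-- `f = g ∘ A` for some affine automorphism `A` of the complex plane. -/
def AffineIso (f g : ℂ[X]) : Prop :=
  ∃ a b : ℂ, a ≠ 0 ∧ f = g.comp (C a * X + C b)

/-! ### Dessins -/

/-- A bicolored graph drawn in the oriented plane: black and white vertices, and the open edges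
as subsets of the plane. -/
structure PlaneDrawing where
  black : Set ℂ
  white : Set ℂ
  edges : Set (Set ℂ)

namespace PlaneDrawing

/-- All points of the drawing: the vertices and the points on the edges. -/
def support (D : PlaneDrawing) : Set ℂ := D.black ∪ D.white ∪ ⋃₀ D.edges

/-- `v` is an end point of the open edge `e`. -/
def Incident (v : ℂ) (e : Set ℂ) : Prop := v ∈ closure e

/-- `e'` is the edge that follows `e` counterclockwise around the vertex `v`: on all small circles
around `v`, some counterclockwise arc (at most a full turn) leads from a point of `e` to a point
of `e'` without meeting the drawing in between. At a vertex with a single edge `e`, the edge `e`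
follows itself. -/
def CcwNext (D : PlaneDrawing) (v : ℂ) (e e' : Set ℂ) : Prop :=
  ∀ᶠ r in 𝓝[>] (0 : ℝ), ∃ θ θ' : ℝ, θ < θ' ∧ θ' ≤ θ + 2 * Real.pi ∧
    circleMap v r θ ∈ e ∧ circleMap v r θ' ∈ e' ∧
    ∀ t ∈ Set.Ioo θ θ', circleMap v r t ∉ D.support

/-- An orientation- and color-preserving isomorphism of cell structures: bijections of black
vertices, white vertices and edges that respect incidence and the counterclockwise order of the
edges around each vertex. (The drawings below are trees, with a single 2-cell, so there is nothing
more to say about 2-cells.) -/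
structure Iso (D D' : PlaneDrawing) where
  onBlack : D.black ≃ D'.black
  onWhite : D.white ≃ D'.white
  onEdges : D.edges ≃ D'.edges
  incident_black : ∀ (v : D.black) (e : D.edges),
    Incident (v : ℂ) (e : Set ℂ) ↔ Incident (onBlack v : ℂ) (onEdges e : Set ℂ)
  incident_white : ∀ (v : D.white) (e : D.edges),
    Incident (v : ℂ) (e : Set ℂ) ↔ Incident (onWhite v : ℂ) (onEdges e : Set ℂ)
  ccw_black : ∀ (v : D.black) (e e' : D.edges),
    D.CcwNext v e e' ↔ D'.CcwNext (onBlack v) (onEdges e) (onEdges e')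
  ccw_white : ∀ (v : D.white) (e e' : D.edges),
    D.CcwNext v e e' ↔ D'.CcwNext (onWhite v) (onEdges e) (onEdges e')

/-- Isomorphism of drawings. -/
def Isomorphic (D D' : PlaneDrawing) : Prop := Nonempty (Iso D D')

end PlaneDrawing

/-- The preimage under `f` of the open segment from `0` to `1`. -/
def openSegmentPreimage (f : ℂ[X]) : Set ℂ := {z | ∃ t ∈ Set.Ioo (0 : ℝ) 1, f.eval z = (t : ℂ)}

/-- The dessin of `f`: the preimage of the segment `[0, 1]`, with the preimages of `0` as black
vertices, the preimages of `1` as white vertices, and the connected components of the preimage of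
the open segment as open edges. -/
def dessin (f : ℂ[X]) : PlaneDrawing where
  black := {z | f.eval z = 0}
  white := {z | f.eval z = 1}
  edges := {e | ∃ z ∈ openSegmentPreimage f, e = connectedComponentIn (openSegmentPreimage f) z}

/-! ### Polynomials with algebraic coefficients and the Galois action -/

/-- The field of algebraic numbers inside `ℂ`. -/
noncomputable abbrev Qbar : IntermediateField ℚ ℂ := algebraicClosure ℚ ℂ

/-- The absolute Galois group of `ℚ`. -/
abbrev AbsGal : Type := Qbar ≃ₐ[ℚ] Qbar

/-- A polynomial with algebraic coefficients, seen as a complex polynomial. -/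
noncomputable def toC (f : Qbar[X]) : ℂ[X] := f.map (algebraMap Qbar ℂ)

/-- The twist of `f` by `σ`: apply `σ` to all coefficients. -/
noncomputable def twist (σ : AbsGal) (f : Qbar[X]) : Qbar[X] := f.map (σ : Qbar →+* Qbar)

theorem toC_injective : Function.Injective toC :=
  Polynomial.map_injective _ (algebraMap Qbar ℂ).injective

theorem toC_comp (f g : Qbar[X]) : toC (f.comp g) = (toC f).comp (toC g) :=
  Polynomial.map_comp _ _ _

theorem twist_comp (σ : AbsGal) (f g : Qbar[X]) :
    twist σ (f.comp g) = (twist σ f).comp (twist σ g) :=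
  Polynomial.map_comp _ _ _

theorem twist_one (f : Qbar[X]) : twist 1 f = f := by
  ext n; simp [twist]

theorem twist_mul (σ τ : AbsGal) (f : Qbar[X]) : twist (σ * τ) f = twist σ (twist τ f) := by
  ext n; simp [twist]

theorem eval_toC (f : Qbar[X]) (w : Qbar) : (toC f).eval (w : ℂ) = ((f.eval w : Qbar) : ℂ) :=
  Polynomial.eval_map_apply (algebraMap Qbar ℂ) w

theorem eval_twist (σ : AbsGal) (f : Qbar[X]) (w : Qbar) :
    (twist σ f).eval (σ w) = σ (f.eval w) :=
  Polynomial.eval_map_apply (σ : Qbar →+* Qbar) w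

theorem derivative_toC (f : Qbar[X]) : (toC f).derivative = toC f.derivative :=
  Polynomial.derivative_map _ _

theorem derivative_twist (σ : AbsGal) (f : Qbar[X]) :
    (twist σ f).derivative = twist σ f.derivative :=
  Polynomial.derivative_map _ _

theorem natDegree_toC (f : Qbar[X]) : (toC f).natDegree = f.natDegree :=
  Polynomial.natDegree_map_eq_of_injective (algebraMap Qbar ℂ).injective _

theorem natDegree_twist (σ : AbsGal) (f : Qbar[X]) : (twist σ f).natDegree = f.natDegree :=
  Polynomial.natDegree_map_eq_of_injective σ.injective _

theorem localDegree_toC (f : Qbar[X]) (w : Qbar) :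
    localDegree (toC f) (w : ℂ) = (f - C (f.eval w)).rootMultiplicity w := by
  rw [localDegree, eval_toC,
    Polynomial.eq_rootMultiplicity_map (p := f - C (f.eval w)) (algebraMap Qbar ℂ).injective w]
  simp [toC]

theorem localDegree_twist (σ : AbsGal) (f : Qbar[X]) (w : Qbar) :
    localDegree (toC (twist σ f)) ((σ w : Qbar) : ℂ) = localDegree (toC f) (w : ℂ) := by
  rw [localDegree_toC, localDegree_toC, eval_twist,
    Polynomial.eq_rootMultiplicity_map (p := f - C (f.eval w))
      (f := (σ : Qbar →+* Qbar)) σ.injective w]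
  simp [twist]

theorem exists_of_eval_eq_zero {p : Qbar[X]} (hp : p ≠ 0) {z : ℂ} (hz : (toC p).eval z = 0) :
    ∃ w : Qbar, (w : ℂ) = z := by
  have h : IsAlgebraic Qbar z := ⟨p, hp, by
    rw [Polynomial.aeval_def, ← Polynomial.eval_map]; exact hz⟩
  have : Algebra.IsAlgebraic ℚ Qbar := algebraicClosure.isAlgebraic ℚ ℂ
  have h' : IsAlgebraic ℚ z := h.restrictScalars ℚ
  exact ⟨⟨z, mem_algebraicClosure_iff.2 h'⟩, rfl⟩

theorem exists_of_eval_eq {p : Qbar[X]} (hp : 0 < p.natDegree) {z : ℂ} {c : Qbar}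
    (hz : (toC p).eval z = (c : ℂ)) : ∃ w : Qbar, (w : ℂ) = z := by
  refine exists_of_eval_eq_zero (p := p - C c) (fun h => ?_) ?_
  · rw [sub_eq_zero.1 h, natDegree_C] at hp
    exact lt_irrefl _ hp
  · simp only [toC, Polynomial.map_sub, Polynomial.map_C, eval_sub, eval_C]
    exact sub_eq_zero.2 hz

theorem exists_of_mem_criticalPoints {f : Qbar[X]} (hf : 0 < f.natDegree) {z : ℂ}
    (hz : z ∈ criticalPoints (toC f)) : ∃ w : Qbar, (w : ℂ) = z := by
  refine exists_of_eval_eq_zero (p := f.derivative) (fun h => ?_) ?_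
  · exact hf.ne' (Polynomial.derivative_eq_zero.1 h)
  · rw [← derivative_toC]; exact hz

theorem mem_criticalPoints_toC (f : Qbar[X]) (w : Qbar) :
    (w : ℂ) ∈ criticalPoints (toC f) ↔ f.derivative.eval w = 0 := by
  change (toC f).derivative.eval (w : ℂ) = 0 ↔ _
  rw [derivative_toC, eval_toC]
  exact_mod_cast Iff.rfl

theorem mem_criticalPoints_twist (σ : AbsGal) (f : Qbar[X]) (w : Qbar) :
    ((σ w : Qbar) : ℂ) ∈ criticalPoints (toC (twist σ f)) ↔ (w : ℂ) ∈ criticalPoints (toC f) := by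
  rw [mem_criticalPoints_toC, mem_criticalPoints_toC, derivative_twist, eval_twist]
  simp

theorem iterate_toC (f : Qbar[X]) (n : ℕ) (w : Qbar) :
    (fun z => (toC f).eval z)^[n] (w : ℂ) = (((fun z => f.eval z)^[n] w : Qbar) : ℂ) := by
  induction n generalizing w with
  | zero => rfl
  | succ n ih => rw [Function.iterate_succ_apply, Function.iterate_succ_apply, eval_toC, ih]

theorem iterate_twist (σ : AbsGal) (f : Qbar[X]) (n : ℕ) (w : Qbar) :
    (fun z => (twist σ f).eval z)^[n] (σ w) = σ ((fun z => f.eval z)^[n] w) := by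
  induction n generalizing w with
  | zero => rfl
  | succ n ih => rw [Function.iterate_succ_apply, Function.iterate_succ_apply, eval_twist, ih]

theorem coe_mem_pair (σ : AbsGal) (x : Qbar) (h : (x : ℂ) ∈ ({0, 1} : Set ℂ)) :
    ((σ x : Qbar) : ℂ) ∈ ({0, 1} : Set ℂ) := by
  rcases h with h | h
  · have : x = 0 := by exact_mod_cast h
    simp [this]
  · have : x = 1 := by
      have h1 : (x : ℂ) = 1 := h
      exact_mod_cast h1
    simp [this]

theorem IsBelyi.twist {f : Qbar[X]} (hf : IsBelyi (toC f)) (σ : AbsGal) :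
    IsBelyi (toC (twist σ f)) := by
  have hd : 3 ≤ f.natDegree := by simpa only [natDegree_toC] using hf.three_le_natDegree
  have hd' : 0 < (BelyiDessin.twist σ f).natDegree := by rw [natDegree_twist]; omega
  refine ⟨by rw [natDegree_toC, natDegree_twist]; exact hd, ?_, ?_⟩
  · rintro _ ⟨z, hz, rfl⟩
    obtain ⟨w', rfl⟩ := exists_of_mem_criticalPoints hd' hz
    obtain ⟨w, rfl⟩ := σ.surjective w'
    have := hf.criticalValues_subset ⟨_, (mem_criticalPoints_twist σ f w).1 hz, rfl⟩
    simp only [eval_toC, eval_twist] at this ⊢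
    exact coe_mem_pair σ _ this
  · intro z hz
    obtain ⟨w', rfl⟩ := exists_of_eval_eq (c := 1) hd' (by simpa using hz)
    obtain ⟨w, rfl⟩ := σ.surjective w'
    rw [localDegree_twist]
    refine hf.clean _ ?_
    rw [eval_toC, eval_twist] at hz
    rw [eval_toC]
    have h1 : σ (f.eval w) = 1 := by exact_mod_cast hz
    have h2 : f.eval w = 1 := σ.injective (by rw [h1, map_one])
    simp [h2]

theorem postcriticalSet_subset_iff (f : ℂ[X]) : postcriticalSet f ⊆ {0, 1} ↔
    ∀ n : ℕ, 0 < n → ∀ c ∈ criticalPoints f,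
      (fun z => f.eval z)^[n] c ∈ ({0, 1} : Set ℂ) := by
  have hc : IsClosed ({0, 1} : Set ℂ) := (Set.toFinite _).isClosed
  rw [postcriticalSet, hc.closure_subset_iff]
  simp only [Set.iUnion_subset_iff, Set.image_subset_iff]
  exact Iff.rfl

theorem IsDynamicalBelyi.twist {f : Qbar[X]} (hf : IsDynamicalBelyi (toC f)) (σ : AbsGal) :
    IsDynamicalBelyi (toC (twist σ f)) := by
  have hd : 3 ≤ f.natDegree := by simpa only [natDegree_toC] using hf.three_le_natDegree
  have hd' : 0 < (BelyiDessin.twist σ f).natDegree := by rw [natDegree_twist]; omega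
  refine ⟨hf.toIsBelyi.twist σ, (postcriticalSet_subset_iff _).2 fun n hn z hz => ?_⟩
  obtain ⟨w', rfl⟩ := exists_of_mem_criticalPoints hd' hz
  obtain ⟨w, rfl⟩ := σ.surjective w'
  have := (postcriticalSet_subset_iff _).1 hf.postcriticalSet_subset n hn _
    ((mem_criticalPoints_twist σ f w).1 hz)
  rw [iterate_toC] at this ⊢
  rw [iterate_twist]
  exact coe_mem_pair σ _ this

theorem IsExtraClean.twist {f : Qbar[X]} (hf : IsExtraClean (toC f)) (σ : AbsGal) :
    IsExtraClean (toC (twist σ f)) := by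
  have key : ∀ w : Qbar, σ w = w → (toC f).eval (w : ℂ) = 0 →
      (toC (BelyiDessin.twist σ f)).eval (w : ℂ) = 0 := by
    intro w hw h
    have h0 : f.eval w = 0 := by rw [eval_toC] at h; exact_mod_cast h
    rw [← hw, eval_toC, eval_twist, h0]; simp
  have h0 := localDegree_twist σ f 0
  have h1 := localDegree_twist σ f 1
  have e0 := key 0 (map_zero σ)
  have e1 := key 1 (map_one σ)
  simp only [map_zero, map_one, ZeroMemClass.coe_zero, OneMemClass.coe_one] at h0 h1 e0 e1
  exact ⟨hf.toIsDynamicalBelyi.twist σ, e0 hf.eval_zero, e1 hf.eval_one,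
    h0.trans hf.localDegree_zero, h1.trans hf.localDegree_one⟩

/-- An affine map that relates two nonconstant polynomials with algebraic coefficients has
algebraic coefficients itself. -/
theorem AffineIso.algebraic {f g : Qbar[X]} (hf : 0 < f.natDegree) (hg : 0 < g.natDegree)
    (h : AffineIso (toC f) (toC g)) :
    ∃ a b : Qbar, a ≠ 0 ∧ f = g.comp (C a * X + C b) := by
  obtain ⟨a, b, ha, hfg⟩ := h
  have hv : ∀ c : Qbar, ∃ z w : Qbar, f.eval z = c ∧ (w : ℂ) = a * z + b := by
    intro c
    obtain ⟨z', hz'⟩ := IsAlgClosed.exists_root (toC f - C (c : ℂ)) (by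
      have hd : (toC f - C (c : ℂ)).natDegree = f.natDegree := by
        rw [natDegree_sub_C, natDegree_toC]
      intro h0
      rw [natDegree_eq_of_degree_eq_some h0] at hd
      exact hf.ne hd)
    have hz : (toC f).eval z' = (c : ℂ) := by
      simpa [sub_eq_zero] using hz'
    obtain ⟨z, rfl⟩ := exists_of_eval_eq hf hz
    have hgz : (toC g).eval (a * z + b) = (c : ℂ) := by
      rw [← hz, hfg]; simp
    obtain ⟨w, hw⟩ := exists_of_eval_eq hg hgz
    exact ⟨z, w, by rw [eval_toC] at hz; exact_mod_cast hz, hw⟩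
  obtain ⟨z₀, w₀, h₀, k₀⟩ := hv 0
  obtain ⟨z₁, w₁, h₁, k₁⟩ := hv 1
  have hne : z₁ - z₀ ≠ 0 := by
    intro h
    rw [sub_eq_zero.1 h, h₀] at h₁
    exact zero_ne_one h₁
  have hneC : (z₁ : ℂ) - z₀ ≠ 0 := by exact_mod_cast hne
  have hA : (((w₁ - w₀) / (z₁ - z₀) : Qbar) : ℂ) = a := by
    push_cast
    rw [k₀, k₁]
    field_simp
    ring
  have hB : ((w₀ - (w₁ - w₀) / (z₁ - z₀) * z₀ : Qbar) : ℂ) = b := by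
    rw [show ((w₀ - (w₁ - w₀) / (z₁ - z₀) * z₀ : Qbar) : ℂ)
      = w₀ - (((w₁ - w₀) / (z₁ - z₀) : Qbar) : ℂ) * z₀ by push_cast; ring, hA, k₀]
    ring
  refine ⟨(w₁ - w₀) / (z₁ - z₀), w₀ - (w₁ - w₀) / (z₁ - z₀) * z₀, fun h0 => ha ?_,
    toC_injective ?_⟩
  · rw [← hA, h0]; simp
  · have hL : toC (C ((w₁ - w₀) / (z₁ - z₀)) * X + C (w₀ - (w₁ - w₀) / (z₁ - z₀) * z₀))
        = C a * X + C b := by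
      rw [← hA, ← hB]
      simp only [toC, Polynomial.map_add, Polynomial.map_mul, Polynomial.map_C, Polynomial.map_X]
      rfl
    rw [toC_comp, hL, hfg]

theorem AffineIso.refl (f : ℂ[X]) : AffineIso f f := ⟨1, 0, one_ne_zero, by simp⟩

theorem AffineIso.symm {f g : ℂ[X]} (h : AffineIso f g) : AffineIso g f := by
  obtain ⟨a, b, ha, rfl⟩ := h
  refine ⟨a⁻¹, -(a⁻¹ * b), inv_ne_zero ha, ?_⟩
  rw [Polynomial.comp_assoc]
  have : (C a * X + C b : ℂ[X]).comp (C a⁻¹ * X + C (-(a⁻¹ * b))) = X := by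
    simp only [add_comp, mul_comp, C_comp, X_comp, mul_add, ← mul_assoc, ← C_mul]
    rw [mul_inv_cancel₀ ha, add_assoc, ← C_add]
    have : a * -(a⁻¹ * b) + b = 0 := by field_simp; ring
    rw [this]; simp
  rw [this, comp_X]

theorem AffineIso.trans {f g h : ℂ[X]} (h₁ : AffineIso f g) (h₂ : AffineIso g h) :
    AffineIso f h := by
  obtain ⟨a, b, ha, rfl⟩ := h₁
  obtain ⟨c, d, hc, rfl⟩ := h₂
  refine ⟨c * a, c * b + d, mul_ne_zero hc ha, ?_⟩
  rw [Polynomial.comp_assoc]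
  congr 1
  simp only [add_comp, mul_comp, C_comp, X_comp, C_mul, C_add]
  ring

/-- The set `BP` of clean Belyi polynomials with algebraic coefficients. -/
def BP : Type := {f : Qbar[X] // IsBelyi (toC f)}

/-- The set `XDBP` of extra-clean dynamical Belyi polynomials with algebraic coefficients. -/
def XDBP : Type := {f : Qbar[X] // IsExtraClean (toC f)}

/-- The Galois group acts on `BP` by twisting coefficients. -/
noncomputable instance : MulAction AbsGal BP where
  smul σ f := ⟨twist σ f.1, f.2.twist σ⟩
  one_smul f := Subtype.ext (twist_one f.1)
  mul_smul σ τ f := Subtype.ext (twist_mul σ τ f.1)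

/-- The Galois group acts on `XDBP` by twisting coefficients. -/
noncomputable instance : MulAction AbsGal XDBP where
  smul σ f := ⟨twist σ f.1, f.2.twist σ⟩
  one_smul f := Subtype.ext (twist_one f.1)
  mul_smul σ τ f := Subtype.ext (twist_mul σ τ f.1)

/-- Isomorphism of Belyi polynomials: affine change of coordinate in the domain. -/
instance bpSetoid : Setoid BP where
  r f g := AffineIso (toC f.1) (toC g.1)
  iseqv := ⟨fun _ => AffineIso.refl _, AffineIso.symm, AffineIso.trans⟩

/-- The set `[BP]` of isomorphism classes of clean Belyi polynomials. -/
def BPClass : Type := Quotient bpSetoid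

theorem smul_congr (σ : AbsGal) (f g : BP) (h : f ≈ g) : σ • f ≈ σ • g := by
  have hd : ∀ k : BP, 0 < k.1.natDegree := fun k => by
    have := k.2.three_le_natDegree
    rw [natDegree_toC] at this
    omega
  obtain ⟨a, b, ha, hab⟩ := AffineIso.algebraic (hd f) (hd g) h
  refine ⟨((σ a : Qbar) : ℂ), ((σ b : Qbar) : ℂ), ?_, ?_⟩
  · have : σ a ≠ 0 := by simpa using ha
    exact_mod_cast this
  · change toC (twist σ f.1) = (toC (twist σ g.1)).comp _
    rw [hab, twist_comp, toC_comp]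
    congr 1
    simp only [twist, toC, Polynomial.map_add, Polynomial.map_mul, Polynomial.map_C,
      Polynomial.map_X]
    rfl

/-- The action of the Galois group on `[BP]` induced by twisting coefficients. -/
noncomputable instance : MulAction AbsGal BPClass where
  smul σ := Quotient.map (fun f => σ • f) (smul_congr σ)
  one_smul := by
    rintro ⟨f⟩
    exact congrArg (Quotient.mk bpSetoid) (one_smul AbsGal f)
  mul_smul σ τ := by
    rintro ⟨f⟩
    exact congrArg (Quotient.mk bpSetoid) (mul_smul σ τ f)

/-- The map `XDBP → [BP]`, `f ↦ [f ∘ f]`; that `f ∘ f` is a clean Belyi polynomial comes from the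
closure of the extra-clean polynomials under composition. -/
noncomputable def secondIterateClass
    (hcomp : ∀ f g : ℂ[X], IsExtraClean f → IsExtraClean g → IsExtraClean (f.comp g))
    (f : XDBP) : BPClass :=
  Quotient.mk bpSetoid ⟨f.1.comp f.1, by
    rw [toC_comp]
    exact (hcomp _ _ f.2 f.2).toIsBelyi⟩

end BelyiDessin

namespace BelyiDessin

open Polynomial Topology Filter

/-! ### Local degrees and composition -/

/-! Closure under composition follows from the chain rule: the inner map sends its critical points
into `{0, 1}`, the outer map sends these to `0`, so over `1` only the ramification of the outer map
is seen.

The statement on second iterates has a topological and an algebraic half.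

Topology: a dessin determines its polynomial up to an affine change of variable
(`affineIso_of_isomorphic`). Off the fibres over `0` and `1`, `F` is a covering. The plane slit
along `(-∞, 0]` and `[1, ∞)` is contractible and contains `(0, 1)`, so its lifts, the sheets,
correspond to the edges. Starting on a sheet, going up and crossing the negative reals into the
lower half plane amounts to a positive loop around `0`; the next sheet is recorded by `IsTurn`.
Since the argument of `F` increases along small circles around a zero, this next sheet belongs to
the counterclockwise next edge (`isTurn_of_ccwNext`, `ccwNext_of_isTurn`). White vertices are
treated through `1 - F`. An isomorphism of dessins therefore matches sheets of `F` and `G`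
compatibly with all crossings, and the maps between matching sheets glue to a holomorphic `Φ` with
`G ∘ Φ = F` off a finite set. Its singularities are removable, its growth is linear, and it is
affine by Liouville (`affineIso_of_isTurn`).

Algebra: if `f ∘ f = g ∘ g ∘ L` with `L` affine, uniqueness of decompositions with given degrees
yields `f = a (g ∘ L) + b` (`exists_affine_of_comp_eq`). Both `0` and `1` are critical values of
`g`; with cleanness and local degree `1` at `0` this forces `b = 0` and `a = 1`. Then `f ∘ f = g ∘
f`, and `f` is surjective (`IsExtraClean.eq_of_affineIso`). Injectivity on `[BP]` needs only this
half. -/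

theorem sub_C_ne_zero {f : ℂ[X]} (hf : 0 < f.natDegree) (c : ℂ) : f - C c ≠ 0 := by
  intro h
  rw [sub_eq_zero.1 h, natDegree_C] at hf
  exact lt_irrefl _ hf

/-- Substituting `g` into `f - f(g z) = (X - g z) ^ k * q` leaves a factor `q ∘ g` that does not
vanish at `z`. -/
theorem localDegree_comp {f g : ℂ[X]} (hf : 0 < f.natDegree) (hg : 0 < g.natDegree) (z : ℂ) :
    localDegree (f.comp g) z = localDegree f (g.eval z) * localDegree g z := by
  have hf0 := sub_C_ne_zero hf (f.eval (g.eval z))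
  have hg0 := sub_C_ne_zero hg (g.eval z)
  obtain ⟨q, hq, hqr⟩ := exists_eq_pow_rootMultiplicity_mul_and_not_dvd _ hf0 (g.eval z)
  rw [dvd_iff_isRoot] at hqr
  have hqz : (q.comp g).eval z ≠ 0 := by rwa [eval_comp]
  have hcomp : f.comp g - C ((f.comp g).eval z)
      = (g - C (g.eval z)) ^ localDegree f (g.eval z) * q.comp g := by
    have := congrArg (fun p : ℂ[X] => p.comp g) hq
    simpa [localDegree] using this
  have hpow : (g - C (g.eval z)) ^ localDegree f (g.eval z) ≠ 0 := pow_ne_zero _ hg0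
  have hq0 : q.comp g ≠ 0 := fun h => hqz (by simp [h])
  rw [localDegree, hcomp, rootMultiplicity_mul (mul_ne_zero hpow hq0),
    rootMultiplicity_eq_zero (p := q.comp g) hqz, add_zero, ← count_roots, roots_pow,
    Multiset.count_nsmul, count_roots]
  rfl

theorem rootMultiplicity_derivative_eq_localDegree_sub_one (f : ℂ[X]) (z : ℂ) :
    f.derivative.rootMultiplicity z = localDegree f z - 1 := by
  have h : (f - C (f.eval z)).derivative = f.derivative := by simp
  rw [localDegree, ← h]
  exact derivative_rootMultiplicity_of_root (by simp)

theorem localDegree_eq_one {f : ℂ[X]} (hf : 0 < f.natDegree) {z : ℂ}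
    (hz : f.derivative.eval z ≠ 0) : localDegree f z = 1 := by
  have h1 : 0 < localDegree f z :=
    (rootMultiplicity_pos (sub_C_ne_zero hf _)).2 (by simp)
  have h2 := rootMultiplicity_derivative_eq_localDegree_sub_one f z
  rw [rootMultiplicity_eq_zero (p := f.derivative) hz] at h2
  omega

theorem mem_criticalPoints_of_localDegree {f : ℂ[X]} {z : ℂ} (hz : 2 ≤ localDegree f z) :
    z ∈ criticalPoints f := by
  by_contra h
  have h2 := rootMultiplicity_derivative_eq_localDegree_sub_one f z
  rw [rootMultiplicity_eq_zero (p := f.derivative) h] at h2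
  omega

theorem mem_criticalPoints_comp {f g : ℂ[X]} {z : ℂ} :
    z ∈ criticalPoints (f.comp g) ↔ z ∈ criticalPoints g ∨ g.eval z ∈ criticalPoints f := by
  simp [criticalPoints, derivative_comp]

theorem IsBelyi.natDegree_pos {f : ℂ[X]} (hf : IsBelyi f) : 0 < f.natDegree := by
  have := hf.three_le_natDegree; omega

theorem IsExtraClean.eval_of_mem_pair {f : ℂ[X]} (hf : IsExtraClean f) {z : ℂ}
    (hz : z ∈ ({0, 1} : Set ℂ)) : f.eval z = 0 := by
  rcases hz with rfl | rfl
  exacts [hf.eval_zero, hf.eval_one]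

theorem IsExtraClean.comp {f g : ℂ[X]} (hf : IsExtraClean f) (hg : IsExtraClean g) :
    IsExtraClean (f.comp g) := by
  have hfd := hf.natDegree_pos
  have hgd := hg.natDegree_pos
  have h0 : (f.comp g).eval 0 = 0 := by rw [eval_comp, hg.eval_zero, hf.eval_zero]
  have h1 : (f.comp g).eval 1 = 0 := by rw [eval_comp, hg.eval_one, hf.eval_zero]
  have hcrit : ∀ z ∈ criticalPoints (f.comp g), (f.comp g).eval z ∈ ({0, 1} : Set ℂ) := by
    intro z hz
    rw [eval_comp]
    rcases mem_criticalPoints_comp.1 hz with hz | hz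
    · exact Or.inl (hf.eval_of_mem_pair (hg.criticalValues_subset ⟨z, hz, rfl⟩))
    · exact hf.criticalValues_subset ⟨_, hz, rfl⟩
  refine { three_le_natDegree := ?_, criticalValues_subset := ?_, clean := ?_,
           postcriticalSet_subset := ?_, eval_zero := h0, eval_one := h1,
           localDegree_zero := ?_, localDegree_one := ?_ }
  · rw [natDegree_comp]
    have := hf.three_le_natDegree
    nlinarith
  · rintro _ ⟨z, hz, rfl⟩
    exact hcrit z hz
  · intro z hz
    rw [eval_comp] at hz
    -- A critical point of `g` goes to `{0, 1}` under `g` and then to `0` under `f`, hence not to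
    -- `1`.
    have hgz : g.derivative.eval z ≠ 0 := by
      intro h
      have := hf.eval_of_mem_pair (hg.criticalValues_subset ⟨z, h, rfl⟩)
      exact zero_ne_one (this.symm.trans hz)
    rw [localDegree_comp hfd hgd, hf.clean _ hz, localDegree_eq_one hgd hgz]
  · refine (postcriticalSet_subset_iff _).2 fun n hn c hc => ?_
    obtain ⟨k, rfl⟩ := Nat.exists_eq_succ_of_ne_zero hn.ne'
    induction k with
    | zero => exact hcrit c hc
    | succ k ih =>
      rw [Function.iterate_succ_apply']
      rcases ih (Nat.succ_pos k) with h | h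
      · rw [h]; exact Or.inl h0
      · rw [Set.mem_singleton_iff.1 h]; exact Or.inl h1
  · rw [localDegree_comp hfd hgd, hg.eval_zero, hf.localDegree_zero, hg.localDegree_zero]
  · rw [localDegree_comp hfd hgd, hg.eval_one, hf.localDegree_zero, hg.localDegree_one]

/-! ### Uniqueness of decompositions of complex polynomials -/

/-- Two decompositions of a polynomial into factors of the same degrees differ by an affine map. -/
theorem exists_affine_of_comp_eq {f g u w : ℂ[X]} (hf : 0 < f.natDegree)
    (hfg : f.natDegree = g.natDegree) (hu : 0 < u.natDegree) (huw : u.natDegree = w.natDegree)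
    (h : f.comp u = g.comp w) : ∃ a b : ℂ, a ≠ 0 ∧ u = C a * w + C b := by
  have hu0 : u.leadingCoeff ≠ 0 := leadingCoeff_ne_zero.2 (ne_zero_of_natDegree_gt hu)
  have hw0 : w.leadingCoeff ≠ 0 := leadingCoeff_ne_zero.2 (ne_zero_of_natDegree_gt (huw ▸ hu))
  have hf0 : f.leadingCoeff ≠ 0 := leadingCoeff_ne_zero.2 (ne_zero_of_natDegree_gt hf)
  set n := f.natDegree with hn
  set m := u.natDegree with hm
  -- The scaling that gives `v = a w` the leading coefficient of `u`; the claim becomes that `u - v`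
  -- is constant.
  set a := u.leadingCoeff / w.leadingCoeff with ha
  have ha0 : a ≠ 0 := div_ne_zero hu0 hw0
  set v := C a * w with hv
  have hvd : v.natDegree = m := by rw [hv, natDegree_C_mul ha0, huw]
  have hvl : v.leadingCoeff = u.leadingCoeff := by
    rw [hv, leadingCoeff_mul, leadingCoeff_C, ha, div_mul_cancel₀ _ hw0]
  have hlead : f.leadingCoeff * a ^ n = g.leadingCoeff := by
    have := congrArg leadingCoeff h
    rw [leadingCoeff_comp hu.ne', leadingCoeff_comp (huw ▸ hu.ne'), ← hfg] at this
    rw [ha, div_pow, ← mul_div_assoc, this, mul_div_cancel_right₀ _ (pow_ne_zero _ hw0)]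
  have hsplit : ∀ p q : ℂ[X], p.comp q
      = C p.leadingCoeff * q ^ p.natDegree + p.eraseLead.comp q := by
    intro p q
    conv_lhs => rw [← eraseLead_add_C_mul_X_pow p]
    rw [add_comp, mul_comp, C_comp, X_pow_comp, add_comm]
  have hdeg : ∀ p q : ℂ[X], p.natDegree = n → q.natDegree = m →
      (p.eraseLead.comp q).natDegree ≤ (n - 1) * m := by
    intro p q hp hq
    refine natDegree_comp_le.trans ?_
    rw [hq]
    exact Nat.mul_le_mul_right _ (hp ▸ eraseLead_natDegree_le p)
  -- The top terms of the two composites differ by a multiple of `u ^ n - v ^ n = Q * (u - v)`; all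
  -- other terms have degree at most `(n - 1) * m`.
  have hdiff : C f.leadingCoeff * ((∑ i ∈ Finset.range n, u ^ i * v ^ (n - 1 - i)) * (u - v))
      = g.eraseLead.comp w - f.eraseLead.comp u := by
    rw [(Commute.all u v).geom_sum₂_mul, hv, mul_pow, ← C_pow, mul_sub, ← mul_assoc, ← C_mul, hlead,
      sub_eq_sub_iff_add_eq_add]
    have := hsplit f u
    rw [h, hsplit g w, ← hfg] at this
    rw [add_comm (g.eraseLead.comp w)]
    exact this.symm
  set Q := ∑ i ∈ Finset.range n, u ^ i * v ^ (n - 1 - i) with hQ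
  -- The `n` summands of `Q` share their degree and leading coefficient, so in characteristic zero
  -- nothing cancels.
  have hQc : Q.coeff ((n - 1) * m) ≠ 0 := by
    have hterm : ∀ i ∈ Finset.range n,
        (u ^ i * v ^ (n - 1 - i)).coeff ((n - 1) * m) = u.leadingCoeff ^ (n - 1) := by
      intro i hi
      have hi' : i ≤ n - 1 := by have := Finset.mem_range.1 hi; omega
      have hd : (u ^ i * v ^ (n - 1 - i)).natDegree = (n - 1) * m := by
        have hu' : u ≠ 0 := ne_zero_of_natDegree_gt hu
        have hv' : v ≠ 0 := ne_zero_of_natDegree_gt (hvd.symm ▸ hu)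
        rw [natDegree_mul (pow_ne_zero _ hu') (pow_ne_zero _ hv'), natDegree_pow, natDegree_pow,
          hvd, ← add_mul, Nat.add_sub_cancel' hi']
      rw [← hd, coeff_natDegree, leadingCoeff_mul, leadingCoeff_pow, leadingCoeff_pow, hvl,
        ← pow_add, Nat.add_sub_cancel' hi']
    rw [hQ, finsetSum_coeff, Finset.sum_congr rfl hterm, Finset.sum_const, Finset.card_range,
      nsmul_eq_mul]
    exact mul_ne_zero (by exact_mod_cast hf.ne') (pow_ne_zero _ hu0)
  have hQd : (n - 1) * m ≤ Q.natDegree := le_natDegree_of_ne_zero hQc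
  have hQ0 : Q ≠ 0 := fun h0 => hQc (by simp [h0])
  have hconst : (u - v).natDegree = 0 := by
    by_contra hne
    have hp0 : u - v ≠ 0 := fun h0 => hne (by simp [h0])
    have hle : (C f.leadingCoeff * (Q * (u - v))).natDegree ≤ (n - 1) * m := by
      rw [hdiff]
      exact (natDegree_sub_le _ _).trans
        (max_le (hdeg g w hfg.symm huw.symm) (hdeg f u rfl rfl))
    rw [natDegree_C_mul hf0, natDegree_mul hQ0 hp0] at hle
    omega
  obtain ⟨b, hb⟩ := natDegree_eq_zero.1 hconst
  exact ⟨a, b, ha0, by rw [hb]; ring⟩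

/-! ### Extra-clean polynomials are determined by their second iterates -/

theorem IsBelyi.one_mem_criticalValues {f : ℂ[X]} (hf : IsBelyi f) : 1 ∈ criticalValues f := by
  obtain ⟨z, hz⟩ := IsAlgClosed.exists_root (f - C 1)
    (fun h => by
      have := natDegree_eq_of_degree_eq_some h
      rw [natDegree_sub_C] at this
      exact hf.natDegree_pos.ne' this)
  have hz1 : f.eval z = 1 := by simpa [sub_eq_zero] using hz
  exact ⟨z, mem_criticalPoints_of_localDegree (hf.clean z hz1).ge, hz1⟩

/-- Otherwise all `d - 1` critical points, with multiplicity, lie over `1`. Each is simple and uses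
up two of the `d` preimages of `1`, so `2 (d - 1) ≤ d`, against `d ≥ 3`. -/
theorem IsBelyi.zero_mem_criticalValues {f : ℂ[X]} (hf : IsBelyi f) : 0 ∈ criticalValues f := by
  by_contra h0
  have hle : f.derivative.roots + f.derivative.roots ≤ (f - C 1).roots := by
    refine Multiset.le_iff_count.2 fun z => ?_
    rw [Multiset.count_add, count_roots, count_roots]
    by_cases hz : f.derivative.eval z = 0
    · have hz1 : f.eval z = 1 := by
        rcases hf.criticalValues_subset ⟨z, hz, rfl⟩ with h | h
        · exact absurd ⟨z, hz, h⟩ h0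
        · exact h
      have h2 := hf.clean z hz1
      rw [rootMultiplicity_derivative_eq_localDegree_sub_one, h2]
      rw [localDegree, hz1] at h2
      omega
    · rw [rootMultiplicity_eq_zero (p := f.derivative) hz]
      exact Nat.zero_le _
  have hcard := Multiset.card_le_card hle
  rw [Multiset.card_add, ← (IsAlgClosed.splits f.derivative).natDegree_eq_card_roots,
    ← (IsAlgClosed.splits (f - C 1)).natDegree_eq_card_roots, natDegree_sub_C,
    natDegree_derivative] at hcard
  have := hf.three_le_natDegree
  omega

theorem criticalPoints_affine_comp_comp {g : ℂ[X]} {a b c d : ℂ} (ha : a ≠ 0) (hc : c ≠ 0) (z : ℂ) :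
    z ∈ criticalPoints (C a * g.comp (C c * X + C d) + C b) ↔ c * z + d ∈ criticalPoints g := by
  simp [criticalPoints, derivative_comp, ha, hc]

theorem IsExtraClean.eq_of_affineIso {f g : ℂ[X]} (hf : IsExtraClean f) (hg : IsExtraClean g)
    (h : AffineIso (f.comp f) (g.comp g)) : f = g := by
  obtain ⟨c, d, hc, h⟩ := h
  have hL : (C c * X + C d : ℂ[X]).natDegree = 1 := natDegree_linear hc
  have hfd := hf.natDegree_pos
  have hgd := hg.natDegree_pos
  have hdeg : f.natDegree = g.natDegree := by
    have := congrArg natDegree h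
    rw [natDegree_comp, natDegree_comp, natDegree_comp, hL, mul_one] at this
    exact Nat.mul_self_inj.1 this
  rw [comp_assoc] at h
  have hwd : (g.comp (C c * X + C d)).natDegree = g.natDegree := by
    rw [natDegree_comp, hL, mul_one]
  obtain ⟨a, b, ha, hab⟩ := exists_affine_of_comp_eq hfd hdeg hfd (hdeg.trans hwd.symm) h
  have hval : ∀ z, f.eval ((z - d) / c) = a * g.eval z + b := by
    intro z
    rw [hab]
    simp only [eval_add, eval_mul, eval_C, eval_comp, eval_X]
    rw [mul_div_cancel₀ _ hc, sub_add_cancel]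
  have hcrit : ∀ z ∈ criticalPoints g, (z - d) / c ∈ criticalPoints f := by
    intro z hz
    rw [hab, criticalPoints_affine_comp_comp ha hc, mul_div_cancel₀ _ hc, sub_add_cancel]
    exact hz
  have hB : ∀ y ∈ criticalValues g, a * y + b ∈ ({0, 1} : Set ℂ) := by
    rintro _ ⟨z, hz, rfl⟩
    rw [← hval]
    exact hf.criticalValues_subset ⟨_, hcrit z hz, rfl⟩
  have h0 : b = 0 := by
    have h0 := hB 0 hg.zero_mem_criticalValues
    rw [mul_zero, zero_add] at h0
    rcases h0 with h0 | h0
    · exact h0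
    · exfalso
      -- If `b = 1`, the point that the affine map sends to `0` lies over `1` for `f`, so it is
      -- critical by cleanness; then `0` is critical for `g`, against local degree `1`.
      have hp : f.eval ((0 - d) / c) = 1 := by
        rw [hval, hg.eval_zero, mul_zero, zero_add]; exact h0
      have h2 := mem_criticalPoints_of_localDegree (hf.clean _ hp).ge
      rw [hab, criticalPoints_affine_comp_comp ha hc, mul_div_cancel₀ _ hc, sub_add_cancel] at h2
      have h3 := rootMultiplicity_derivative_eq_localDegree_sub_one g 0
      rw [hg.localDegree_zero] at h3
      have hg' : g.derivative ≠ 0 := fun h' =>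
        hgd.ne' (derivative_eq_zero.1 h')
      exact ((rootMultiplicity_pos hg').2 h2).ne' h3
  have h1 : a = 1 := by
    rcases hB 1 hg.one_mem_criticalValues with h1 | h1
    · rw [h0] at h1; simp [ha] at h1
    · rw [h0] at h1; simpa using h1
  rw [h0, h1, C_1, one_mul, C_0, add_zero] at hab
  -- Now `g ∘ L` is `f` itself, so `h` reads `f ∘ f = g ∘ f`, and `f` is surjective.
  rw [← hab] at h
  refine Polynomial.funext fun x => ?_
  obtain ⟨y, hy⟩ := IsAlgClosed.exists_root (f - C x)
    (fun h => by
      have := natDegree_eq_of_degree_eq_some h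
      rw [natDegree_sub_C] at this
      exact hfd.ne' this)
  have hy : f.eval y = x := by simpa [sub_eq_zero] using hy
  have := congrArg (eval y) h
  rwa [eval_comp, eval_comp, hy] at this

/-! ### Branches of the inverse of a polynomial -/

/-- `s` is a continuous branch of the inverse of `F` over `T`. -/
structure IsBranch (F : ℂ[X]) (T : Set ℂ) (s : ℂ → ℂ) : Prop where
  continuousOn : ContinuousOn s T
  eval_apply : ∀ w ∈ T, F.eval (s w) = w

theorem IsBranch.mono {F : ℂ[X]} {T T' : Set ℂ} {s : ℂ → ℂ} (h : IsBranch F T s) (hT : T' ⊆ T) :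
    IsBranch F T' s :=
  ⟨h.continuousOn.mono hT, fun w hw => h.eval_apply w (hT hw)⟩

theorem derivative_eval_ne_zero {F : ℂ[X]} (hF : criticalValues F ⊆ {0, 1}) {z : ℂ}
    (hz : F.eval z ∉ ({0, 1} : Set ℂ)) : F.derivative.eval z ≠ 0 :=
  fun h => hz (hF ⟨z, h, rfl⟩)

theorem isCoveringMapOn_eval_compl_pair {F : ℂ[X]} (hF : criticalValues F ⊆ {0, 1}) :
    IsCoveringMapOn F.eval ({0, 1} : Set ℂ)ᶜ :=
  F.isCoveringMapOn_eval.mono (Set.compl_subset_compl.2 hF)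

/-- Two lifts of a map to the regular values of `F` agree if they agree at one point. -/
theorem eqOn_of_eval_eq {F : ℂ[X]} (hF : criticalValues F ⊆ {0, 1}) {A : Type*}
    [TopologicalSpace A] {K : Set A} (hK : IsPreconnected K) {g₁ g₂ : A → ℂ}
    (h₁ : ContinuousOn g₁ K) (h₂ : ContinuousOn g₂ K)
    (he : ∀ a ∈ K, F.eval (g₁ a) = F.eval (g₂ a))
    (hr : ∀ a ∈ K, F.eval (g₁ a) ∉ ({0, 1} : Set ℂ)) {a : A} (ha : a ∈ K) (hag : g₁ a = g₂ a) :
    Set.EqOn g₁ g₂ K := by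
  have cov := (isCoveringMapOn_eval_compl_pair hF).isCoveringMap_restrictPreimage
  have : PreconnectedSpace K := isPreconnected_iff_preconnectedSpace.1 hK
  rw [continuousOn_iff_continuous_domRestrict] at h₁ h₂
  let k₁ : K → F.eval ⁻¹' ({0, 1} : Set ℂ)ᶜ := fun x => ⟨g₁ x, hr x x.2⟩
  let k₂ : K → F.eval ⁻¹' ({0, 1} : Set ℂ)ᶜ := fun x => ⟨g₂ x, by
    have := hr x x.2
    rwa [he x x.2] at this⟩
  have hk := cov.eq_of_comp_eq (g₁ := k₁) (g₂ := k₂) (h₁.subtype_mk _) (h₂.subtype_mk _)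
    (funext fun x => Subtype.ext (he x x.2)) ⟨a, ha⟩ (Subtype.ext hag)
  exact fun x hx => congrArg Subtype.val (congrFun hk ⟨x, hx⟩)

theorem IsBranch.eqOn {F : ℂ[X]} (hF : criticalValues F ⊆ {0, 1}) {T : Set ℂ} {s₁ s₂ : ℂ → ℂ}
    (h₁ : IsBranch F T s₁) (h₂ : IsBranch F T s₂) (hT : IsPreconnected T)
    (hr : T ⊆ ({0, 1} : Set ℂ)ᶜ) {w : ℂ} (hw : w ∈ T) (hs : s₁ w = s₂ w) : Set.EqOn s₁ s₂ T :=
  eqOn_of_eval_eq hF hT h₁.continuousOn h₂.continuousOn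
    (fun a ha => by rw [h₁.eval_apply a ha, h₂.eval_apply a ha])
    (fun a ha => by rw [h₁.eval_apply a ha]; exact hr ha) hw hs

/-- A branch inverts `F` on any connected set of preimages that meets its image. -/
theorem IsBranch.apply_eval {F : ℂ[X]} (hF : criticalValues F ⊆ {0, 1}) {T : Set ℂ} {s : ℂ → ℂ}
    (hs : IsBranch F T s) (hr : T ⊆ ({0, 1} : Set ℂ)ᶜ) {K : Set ℂ} (hK : IsPreconnected K)
    (hKT : Set.MapsTo F.eval K T) {z : ℂ} (hz : z ∈ K) (hsz : s (F.eval z) = z) {y : ℂ}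
    (hy : y ∈ K) : s (F.eval y) = y :=
  -- Both `s ∘ F` and the identity lift `F` restricted to `K`.
  eqOn_of_eval_eq hF hK (g₁ := fun y => s (F.eval y)) (g₂ := fun y => y)
    (hs.continuousOn.comp F.continuous.continuousOn hKT) continuousOn_id
    (fun a ha => hs.eval_apply _ (hKT ha))
    (fun a ha => by rw [hs.eval_apply _ (hKT ha)]; exact hr (hKT ha)) hz hsz hy

theorem IsBranch.eventually_apply_eval {F : ℂ[X]} (hF : criticalValues F ⊆ {0, 1}) {T : Set ℂ}
    {s : ℂ → ℂ} (hs : IsBranch F T s) (hT : IsOpen T) (hr : T ⊆ ({0, 1} : Set ℂ)ᶜ) {z : ℂ}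
    (hz : F.eval z ∈ T) (hsz : s (F.eval z) = z) :
    ∀ᶠ y in 𝓝 z, F.eval y ∈ T ∧ s (F.eval y) = y := by
  obtain ⟨ε, hε, hball⟩ := Metric.isOpen_iff.1 (hT.preimage F.continuous) z hz
  filter_upwards [Metric.ball_mem_nhds z hε] with y hy
  exact ⟨hball hy, hs.apply_eval hF hr (convex_ball z ε).isPreconnected (fun y hy => hball hy)
    (Metric.mem_ball_self hε) hsz hy⟩

theorem IsBranch.differentiableAt {F : ℂ[X]} (hF : criticalValues F ⊆ {0, 1}) {T : Set ℂ}
    {s : ℂ → ℂ} (hs : IsBranch F T s) (hT : IsOpen T) (hr : T ⊆ ({0, 1} : Set ℂ)ᶜ) {w : ℂ}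
    (hw : w ∈ T) : DifferentiableAt ℂ s w := by
  have hne : F.derivative.eval (s w) ≠ 0 :=
    derivative_eval_ne_zero hF (by rw [hs.eval_apply w hw]; exact hr hw)
  refine (HasDerivAt.of_local_left_inverse (hs.continuousOn.continuousAt (hT.mem_nhds hw))
    (F.hasDerivAt (s w)) hne ?_).differentiableAt
  filter_upwards [hT.mem_nhds hw] with y hy using hs.eval_apply y hy

/-- An open star-convex set is contractible and locally path connected, so its inclusion into the
regular values lifts through the covering `F`. -/
theorem exists_isBranch {F : ℂ[X]} (hF : criticalValues F ⊆ {0, 1}) {T : Set ℂ} (hT : IsOpen T)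
    {c : ℂ} (hst : StarConvex ℝ c T) (hr : T ⊆ ({0, 1} : Set ℂ)ᶜ) {z : ℂ} (hz : F.eval z ∈ T) :
    ∃ s, IsBranch F T s ∧ s (F.eval z) = z := by
  have : ContractibleSpace T := hst.contractibleSpace ⟨_, hz⟩
  have : LocallyPathConnectedSpace T := hT.locallyPathConnectedSpace
  obtain ⟨φ, ⟨h0, h1⟩, -⟩ :=
    (isCoveringMapOn_eval_compl_pair hF).existsUnique_continuousMap_lifts
      (⟨Subtype.val, continuous_subtype_val⟩ : C(T, ℂ)) (a₀ := ⟨F.eval z, hz⟩) (e₀ := z) rfl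
      (fun a => hr a.2)
  classical
  refine ⟨fun w => if h : w ∈ T then φ ⟨w, h⟩ else 0, ⟨?_, fun w hw => ?_⟩, ?_⟩
  · rw [continuousOn_iff_continuous_domRestrict]
    convert φ.continuous using 1
    ext ⟨x, hx⟩
    simp [hx]
  · simp only [hw, dif_pos]
    exact congrFun h1 ⟨w, hw⟩
  · simp only [hz, dif_pos]
    exact h0

/-! ### The two slit planes -/

/-- The plane slit along the real rays from `0` to `-∞` and from `1` to `∞`. -/
def doubleSlit : Set ℂ := {w | w.im ≠ 0 ∨ (0 < w.re ∧ w.re < 1)}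

/-- The plane slit along the nonnegative reals. -/
def posSlit : Set ℂ := {w | w.im ≠ 0 ∨ w.re < 0}

def upperHalf : Set ℂ := {w | 0 < w.im}

def lowerHalf : Set ℂ := {w | w.im < 0}

theorem isOpen_doubleSlit : IsOpen doubleSlit :=
  (isOpen_ne_fun Complex.continuous_im continuous_const).union
    ((isOpen_lt continuous_const Complex.continuous_re).inter
      (isOpen_lt Complex.continuous_re continuous_const))

theorem isOpen_posSlit : IsOpen posSlit :=
  (isOpen_ne_fun Complex.continuous_im continuous_const).union
    (isOpen_lt Complex.continuous_re continuous_const)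

theorem doubleSlit_subset : doubleSlit ⊆ ({0, 1} : Set ℂ)ᶜ := by
  rintro w hw (rfl | rfl) <;> simp [doubleSlit] at hw

theorem posSlit_subset : posSlit ⊆ ({0, 1} : Set ℂ)ᶜ := by
  rintro w hw (rfl | rfl) <;> norm_num [posSlit] at hw

theorem starConvex_doubleSlit : StarConvex ℝ ((1 / 2 : ℝ) : ℂ) doubleSlit := by
  rw [starConvex_iff_forall_pos (by right; norm_num)]
  rintro w (hw | hw) a b ha hb hab
  · left
    simpa using ⟨hb.ne', hw⟩
  · right
    simp only [Complex.add_re, Complex.real_smul, Complex.re_ofReal_mul, Complex.ofReal_re]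
    constructor <;> nlinarith

theorem starConvex_posSlit : StarConvex ℝ ((-1 : ℝ) : ℂ) posSlit := by
  rw [starConvex_iff_forall_pos (by right; norm_num)]
  rintro w (hw | hw) a b ha hb hab
  · left
    simpa using ⟨hb.ne', hw⟩
  · right
    simp only [Complex.add_re, Complex.real_smul, Complex.re_ofReal_mul, Complex.ofReal_re]
    nlinarith

theorem isPreconnected_doubleSlit : IsPreconnected doubleSlit :=
  (starConvex_doubleSlit.isPathConnected (Or.inr (by norm_num))).isConnected.isPreconnected

theorem isPreconnected_posSlit : IsPreconnected posSlit :=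
  (starConvex_posSlit.isPathConnected (Or.inr (by norm_num))).isConnected.isPreconnected

theorem isPreconnected_upperHalf : IsPreconnected upperHalf :=
  (convex_halfSpace_im_gt 0).isPreconnected

theorem isPreconnected_lowerHalf : IsPreconnected lowerHalf :=
  (convex_halfSpace_im_lt 0).isPreconnected

theorem upperHalf_subset_doubleSlit : upperHalf ⊆ doubleSlit := fun _ hw => Or.inl (ne_of_gt hw)

theorem lowerHalf_subset_doubleSlit : lowerHalf ⊆ doubleSlit := fun _ hw => Or.inl (ne_of_lt hw)

theorem upperHalf_subset_posSlit : upperHalf ⊆ posSlit := fun _ hw => Or.inl (ne_of_gt hw)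

theorem lowerHalf_subset_posSlit : lowerHalf ⊆ posSlit := fun _ hw => Or.inl (ne_of_lt hw)

theorem ofReal_mem_doubleSlit {x : ℝ} (hx : x ∈ Set.Ioo (0 : ℝ) 1) : (x : ℂ) ∈ doubleSlit :=
  Or.inr (by simpa using hx)

theorem one_sub_mem_doubleSlit {w : ℂ} (hw : w ∈ doubleSlit) : 1 - w ∈ doubleSlit := by
  rcases hw with h | h
  · left; simpa using h
  · right
    simp only [Complex.sub_re, Complex.one_re]
    constructor <;> linarith [h.1, h.2]

/-- Three slit planes cover the twice punctured plane, one for each of the real intervals left of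
`0`, between `0` and `1`, and right of `1`. -/
theorem mem_slits_of_notMem_pair {w : ℂ} (hw : w ∉ ({0, 1} : Set ℂ)) :
    w ∈ doubleSlit ∨ w ∈ posSlit ∨ 1 - w ∈ posSlit := by
  by_cases him : w.im = 0
  · rcases lt_trichotomy w.re 0 with h | h | h
    · exact Or.inr (Or.inl (Or.inr h))
    · exact absurd (Or.inl (Complex.ext h him)) hw
    · rcases lt_trichotomy w.re 1 with h' | h' | h'
      · exact Or.inl (Or.inr ⟨h, h'⟩)
      · exact absurd (Or.inr (Complex.ext h' him)) hw
      · exact Or.inr (Or.inr (Or.inr (by simpa using h')))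
  · exact Or.inl (Or.inl him)

/-! ### Edges and sheets -/

/-- `s` is the branch over the doubly slit plane that carries the open segment to the edge `e`. -/
structure IsSheet (F : ℂ[X]) (e : Set ℂ) (s : ℂ → ℂ) : Prop extends IsBranch F doubleSlit s where
  mem_edges : e ∈ (dessin F).edges
  mem_edge : ∀ x ∈ Set.Ioo (0 : ℝ) 1, s x ∈ e

theorem edge_subset {F : ℂ[X]} {e : Set ℂ} (he : e ∈ (dessin F).edges) :
    e ⊆ openSegmentPreimage F := by
  obtain ⟨z, hz, rfl⟩ := he
  exact connectedComponentIn_subset _ _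

theorem edge_isPreconnected {F : ℂ[X]} {e : Set ℂ} (he : e ∈ (dessin F).edges) :
    IsPreconnected e := by
  obtain ⟨z, hz, rfl⟩ := he
  exact isPreconnected_connectedComponentIn

theorem edge_eq_of_mem {F : ℂ[X]} {e e' : Set ℂ} (he : e ∈ (dessin F).edges)
    (he' : e' ∈ (dessin F).edges) {z : ℂ} (hz : z ∈ e) (hz' : z ∈ e') : e = e' := by
  obtain ⟨y, hy, rfl⟩ := he
  obtain ⟨y', hy', rfl⟩ := he'
  exact (connectedComponentIn_eq hz).trans (connectedComponentIn_eq hz').symm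

theorem exists_edge_mem {F : ℂ[X]} {z : ℂ} (hz : z ∈ openSegmentPreimage F) :
    ∃ e ∈ (dessin F).edges, z ∈ e :=
  ⟨_, ⟨z, hz, rfl⟩, mem_connectedComponentIn hz⟩

theorem eval_mem_doubleSlit {F : ℂ[X]} {z : ℂ} (hz : z ∈ openSegmentPreimage F) :
    F.eval z ∈ doubleSlit := by
  obtain ⟨t, ht, h⟩ := hz
  rw [h]
  exact ofReal_mem_doubleSlit ht

theorem isPreconnected_ofReal_image_Ioo :
    IsPreconnected ((fun x : ℝ => (x : ℂ)) '' Set.Ioo (0 : ℝ) 1) :=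
  isPreconnected_Ioo.image _ Complex.continuous_ofReal.continuousOn

theorem half_mem_Ioo : (1 / 2 : ℝ) ∈ Set.Ioo (0 : ℝ) 1 := by norm_num

theorem IsBranch.isSheet_of_mem {F : ℂ[X]} {s : ℂ → ℂ} (hs : IsBranch F doubleSlit s) {e : Set ℂ}
    (he : e ∈ (dessin F).edges) {x : ℝ} (hx : x ∈ Set.Ioo (0 : ℝ) 1) (hxe : s x ∈ e) :
    IsSheet F e s := by
  refine ⟨hs, he, fun y hy => ?_⟩
  obtain ⟨z, hz, rfl⟩ := he
  rw [connectedComponentIn_eq hxe]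
  have hpre : IsPreconnected (s '' ((fun x : ℝ => (x : ℂ)) '' Set.Ioo (0 : ℝ) 1)) :=
    isPreconnected_ofReal_image_Ioo.image _ (hs.continuousOn.mono (by
      rintro _ ⟨x, hx, rfl⟩
      exact ofReal_mem_doubleSlit hx))
  refine hpre.subset_connectedComponentIn ⟨_, ⟨x, hx, rfl⟩, rfl⟩ ?_ ⟨_, ⟨y, hy, rfl⟩, rfl⟩
  rintro _ ⟨_, ⟨t, ht, rfl⟩, rfl⟩
  exact ⟨t, ht, hs.eval_apply _ (ofReal_mem_doubleSlit ht)⟩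

theorem IsBranch.exists_isSheet {F : ℂ[X]} {s : ℂ → ℂ} (hs : IsBranch F doubleSlit s) :
    ∃ e, IsSheet F e s := by
  obtain ⟨e, he, hse⟩ := exists_edge_mem (F := F) (z := s ((1 / 2 : ℝ) : ℂ))
    ⟨_, half_mem_Ioo, hs.eval_apply _ (ofReal_mem_doubleSlit half_mem_Ioo)⟩
  exact ⟨e, hs.isSheet_of_mem he half_mem_Ioo hse⟩

theorem exists_isSheet_of_mem_edge {F : ℂ[X]} (hF : criticalValues F ⊆ {0, 1}) {e : Set ℂ}
    (he : e ∈ (dessin F).edges) : ∃ s, IsSheet F e s := by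
  have he' := he
  obtain ⟨z, hz, rfl⟩ := he'
  obtain ⟨s, hs, hsz⟩ := exists_isBranch hF isOpen_doubleSlit starConvex_doubleSlit
    doubleSlit_subset (eval_mem_doubleSlit hz)
  obtain ⟨t, ht, h⟩ := hz
  refine ⟨s, hs.isSheet_of_mem he ht ?_⟩
  rw [← h, hsz]
  exact mem_connectedComponentIn ⟨t, ht, h⟩

/-- The edge is connected and contains the value of `s` at `1/2`, so the identity and `s ∘ F` agree
on all of it. In particular `F` is injective on an edge. -/
theorem IsSheet.apply_eval {F : ℂ[X]} (hF : criticalValues F ⊆ {0, 1}) {e : Set ℂ} {s : ℂ → ℂ}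
    (hs : IsSheet F e s) {z : ℂ} (hz : z ∈ e) : s (F.eval z) = z := by
  have hm := hs.mem_edge _ half_mem_Ioo
  refine hs.toIsBranch.apply_eval hF doubleSlit_subset (edge_isPreconnected hs.mem_edges)
    (fun y hy => eval_mem_doubleSlit (edge_subset hs.mem_edges hy)) hm ?_ hz
  rw [hs.eval_apply _ (ofReal_mem_doubleSlit half_mem_Ioo)]

theorem IsSheet.eqOn {F : ℂ[X]} (hF : criticalValues F ⊆ {0, 1}) {e : Set ℂ} {s s' : ℂ → ℂ}
    (hs : IsSheet F e s) (hs' : IsSheet F e s') : Set.EqOn s s' doubleSlit := by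
  have h2 := ofReal_mem_doubleSlit half_mem_Ioo
  refine hs.toIsBranch.eqOn hF hs'.toIsBranch isPreconnected_doubleSlit doubleSlit_subset h2 ?_
  have := hs.apply_eval hF (hs'.mem_edge _ half_mem_Ioo)
  rwa [hs'.eval_apply _ h2] at this

/-- Sheets of distinct edges are disjoint: branches that meet over `w` agree on the whole slit
plane, hence also over the segment. -/
theorem IsSheet.edge_eq {F : ℂ[X]} (hF : criticalValues F ⊆ {0, 1}) {e e' : Set ℂ} {s s' : ℂ → ℂ}
    (hs : IsSheet F e s) (hs' : IsSheet F e' s') {w : ℂ} (hw : w ∈ doubleSlit)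
    (h : s w = s' w) : e = e' := by
  have heq := hs.toIsBranch.eqOn hF hs'.toIsBranch isPreconnected_doubleSlit doubleSlit_subset hw h
  refine edge_eq_of_mem hs.mem_edges hs'.mem_edges (hs.mem_edge _ half_mem_Ioo) ?_
  rw [heq (ofReal_mem_doubleSlit half_mem_Ioo)]
  exact hs'.mem_edge _ half_mem_Ioo

/-! ### Crossing from one sheet to the next around the preimages of `0` -/

/-- The sheet of `e'` continues the sheet of `e` from the upper to the lower half plane across the
negative reals. -/
def IsTurn (F : ℂ[X]) (e e' : Set ℂ) : Prop :=
  ∃ s s₁ s₂ : ℂ → ℂ, IsBranch F posSlit s ∧ IsSheet F e s₁ ∧ IsSheet F e' s₂ ∧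
    Set.EqOn s s₁ upperHalf ∧ Set.EqOn s s₂ lowerHalf

/-- A branch over a subset of the doubly slit plane extends to a sheet. -/
theorem IsBranch.exists_isSheet_eqOn {F : ℂ[X]} (hF : criticalValues F ⊆ {0, 1}) {H : Set ℂ}
    {s : ℂ → ℂ} (hs : IsBranch F H s) (hH : IsPreconnected H) (hHne : H.Nonempty)
    (hHs : H ⊆ doubleSlit) : ∃ e s', IsSheet F e s' ∧ Set.EqOn s s' H := by
  obtain ⟨w, hw⟩ := hHne
  have hw' := hs.eval_apply w hw
  obtain ⟨s', hs', h⟩ := exists_isBranch hF isOpen_doubleSlit starConvex_doubleSlit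
    doubleSlit_subset (z := s w) (by rw [hw']; exact hHs hw)
  obtain ⟨e, he⟩ := hs'.exists_isSheet
  rw [hw'] at h
  exact ⟨e, s', he, hs.eqOn hF (hs'.mono hHs) hH (hHs.trans doubleSlit_subset) hw h.symm⟩

theorem IsBranch.exists_isTurn {F : ℂ[X]} (hF : criticalValues F ⊆ {0, 1}) {s : ℂ → ℂ}
    (hs : IsBranch F posSlit s) : ∃ e e' s₁ s₂, IsSheet F e s₁ ∧ IsSheet F e' s₂ ∧
      Set.EqOn s s₁ upperHalf ∧ Set.EqOn s s₂ lowerHalf := by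
  obtain ⟨e, s₁, h₁, k₁⟩ := (hs.mono upperHalf_subset_posSlit).exists_isSheet_eqOn hF
    isPreconnected_upperHalf ⟨Complex.I, by simp [upperHalf]⟩ upperHalf_subset_doubleSlit
  obtain ⟨e', s₂, h₂, k₂⟩ := (hs.mono lowerHalf_subset_posSlit).exists_isSheet_eqOn hF
    isPreconnected_lowerHalf ⟨-Complex.I, by simp [lowerHalf]⟩ lowerHalf_subset_doubleSlit
  exact ⟨e, e', s₁, s₂, h₁, h₂, k₁, k₂⟩

/-- The sheet of `e` fixes the branch over the upper half plane, hence over `posSlit`, hence over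
the lower half plane, and this fixes the next sheet. -/
theorem IsTurn.right_unique {F : ℂ[X]} (hF : criticalValues F ⊆ {0, 1}) {e e' e'' : Set ℂ}
    (h : IsTurn F e e') (h' : IsTurn F e e'') : e' = e'' := by
  obtain ⟨s, s₁, s₂, hs, h₁, h₂, k₁, k₂⟩ := h
  obtain ⟨t, t₁, t₂, ht, h₁', h₂', k₁', k₂'⟩ := h'
  have hI : Complex.I ∈ upperHalf := by simp [upperHalf]
  have hI' : -Complex.I ∈ lowerHalf := by simp [lowerHalf]
  have hst : Set.EqOn s t posSlit := hs.eqOn hF ht isPreconnected_posSlit posSlit_subset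
    (upperHalf_subset_posSlit hI)
    (by rw [k₁ hI, k₁' hI]; exact h₁.eqOn hF h₁' (upperHalf_subset_doubleSlit hI))
  refine h₂.edge_eq hF h₂' (lowerHalf_subset_doubleSlit hI') ?_
  rw [← k₂ hI', ← k₂' hI']
  exact hst (lowerHalf_subset_posSlit hI')

/-! ### The counterclockwise order around a preimage of `0` -/

/-- Near a zero `v` of `F`, the argument of `F` increases along circles around `v`. -/
theorem eventually_re_logDeriv_pos {F : ℂ[X]} (hF0 : F ≠ 0) {v : ℂ} (hv : F.eval v = 0) :
    ∀ᶠ z in 𝓝[≠] v, F.eval z ≠ 0 ∧ ‖F.eval z‖ < 1 ∧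
      0 < ((z - v) * F.derivative.eval z / F.eval z).re := by
  obtain ⟨q, hq, hqr⟩ := exists_eq_pow_rootMultiplicity_mul_and_not_dvd F hF0 v
  rw [dvd_iff_isRoot] at hqr
  have hk : 0 < F.rootMultiplicity v := (rootMultiplicity_pos hF0).2 hv
  obtain ⟨k, hk⟩ := Nat.exists_eq_succ_of_ne_zero hk.ne'
  rw [hk] at hq
  have hqv : q.eval v ≠ 0 := hqr
  have hnorm : ∀ᶠ z in 𝓝 v, ‖F.eval z‖ < 1 := by
    refine F.continuous.norm.continuousAt.eventually_lt continuousAt_const ?_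
    simp [hv]
  have hqz : ∀ᶠ z in 𝓝 v, q.eval z ≠ 0 := q.continuous.continuousAt.eventually_ne hqv
  -- With `F = (z - v) ^ (k + 1) * q`, the expression `(z - v) F' / F` equals `(k + 1) + (z - v) q'
  -- / q`, which tends to `k + 1 > 0`.
  have hre : ∀ᶠ z in 𝓝 v,
      0 < (((k + 1 : ℕ) : ℂ) + (z - v) * q.derivative.eval z / q.eval z).re := by
    have hc : ContinuousAt
        (fun z => (((k + 1 : ℕ) : ℂ) + (z - v) * q.derivative.eval z / q.eval z).re) v := by
      refine Complex.continuous_re.continuousAt.comp (continuousAt_const.add ?_)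
      exact ((continuousAt_id.sub continuousAt_const).mul q.derivative.continuous.continuousAt).div
        q.continuous.continuousAt hqv
    refine continuousAt_const.eventually_lt hc ?_
    simp only [sub_self, zero_mul, zero_div, add_zero, Complex.natCast_re]
    positivity
  filter_upwards [self_mem_nhdsWithin, nhdsWithin_le_nhds hnorm, nhdsWithin_le_nhds hqz,
    nhdsWithin_le_nhds hre] with z hz h1 h2 h3
  have hzv : z - v ≠ 0 := sub_ne_zero.2 hz
  have hFz : F.eval z = (z - v) ^ (k + 1) * q.eval z := by
    conv_lhs => rw [hq]
    simp
  have hF'z : F.derivative.eval z = ((k + 1 : ℕ) : ℂ) * (z - v) ^ k * q.eval z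
      + (z - v) ^ (k + 1) * q.derivative.eval z := by
    conv_lhs => rw [hq]
    simp [derivative_mul, derivative_pow]
  refine ⟨?_, h1, ?_⟩
  · rw [hFz]
    exact mul_ne_zero (pow_ne_zero _ hzv) h2
  · convert h3 using 2
    rw [hFz, hF'z]
    field_simp
    ring

/-- Radii so small that the argument of `F` increases along the circle around `v`. -/
def IsSmallRadius (F : ℂ[X]) (v : ℂ) (r : ℝ) : Prop :=
  ∀ t : ℝ, F.eval (circleMap v r t) ≠ 0 ∧ ‖F.eval (circleMap v r t)‖ < 1 ∧
    0 < ((circleMap v r t - v) * F.derivative.eval (circleMap v r t)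
      / F.eval (circleMap v r t)).re

theorem eventually_isSmallRadius {F : ℂ[X]} (hF0 : F ≠ 0) {v : ℂ} (hv : F.eval v = 0) :
    ∀ᶠ r in 𝓝[>] (0 : ℝ), IsSmallRadius F v r := by
  obtain ⟨ε, hε, h⟩ := Metric.eventually_nhds_iff.1
    (eventually_nhdsWithin_iff.1 (eventually_re_logDeriv_pos hF0 hv))
  filter_upwards [Ioo_mem_nhdsGT hε] with r hr t
  refine h ?_ (circleMap_ne_center hr.1.ne')
  rw [dist_eq_norm, circleMap_sub_center, norm_circleMap_zero, abs_of_pos hr.1]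
  exact hr.2

/-- Along the circle `F` has derivative `F' (z - v) i`. At a positive real value its imaginary part
is positive, so the circle crosses the positive reals upwards. -/
theorem IsSmallRadius.eventually_im {F : ℂ[X]} {v : ℂ} {r : ℝ} (h : IsSmallRadius F v r) {θ x : ℝ}
    (hx : 0 < x) (hθ : F.eval (circleMap v r θ) = x) :
    (∀ᶠ t in 𝓝[>] θ, F.eval (circleMap v r t) ∈ upperHalf) ∧
      ∀ᶠ t in 𝓝[<] θ, F.eval (circleMap v r t) ∈ lowerHalf := by
  have hd : HasDerivAt (fun t => (F.eval (circleMap v r t)).im)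
      ((F.derivative.eval (circleMap v r θ) * (circleMap 0 r θ * Complex.I)).im) θ := by
    have h1 : HasDerivAt (fun t => F.eval (circleMap v r t)) _ θ :=
      (F.hasDerivAt (circleMap v r θ)).comp θ (hasDerivAt_circleMap v r θ)
    exact Complex.imCLM.hasFDerivAt.comp_hasDerivAt θ h1
  have hpos : 0 < (F.derivative.eval (circleMap v r θ) * (circleMap 0 r θ * Complex.I)).im := by
    have h3 := (h θ).2.2
    rw [hθ, circleMap_sub_center, Complex.div_ofReal_re] at h3
    have h4 := (div_pos_iff_of_pos_right hx).1 h3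
    rw [← mul_assoc, Complex.mul_I_im, mul_comm]
    exact h4
  have hz : (F.eval (circleMap v r θ)).im = 0 := by rw [hθ, Complex.ofReal_im]
  rw [← hd.deriv] at hpos
  have hs := eventually_nhdsWithin_sign_eq_of_deriv_pos hpos hz
  constructor
  · filter_upwards [nhdsWithin_le_nhds hs, self_mem_nhdsWithin] with t ht h'
    rw [sign_pos (sub_pos.2 h')] at ht
    exact sign_eq_one_iff.1 ht
  · filter_upwards [nhdsWithin_le_nhds hs, self_mem_nhdsWithin] with t ht h'
    rw [sign_neg (sub_neg.2 h')] at ht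
    exact sign_eq_neg_one_iff.1 ht

theorem mem_support_dessin {F : ℂ[X]} {z : ℂ} :
    z ∈ (dessin F).support ↔ ∃ t ∈ Set.Icc (0 : ℝ) 1, F.eval z = (t : ℂ) := by
  constructor
  · rintro ((h | h) | ⟨e, he, hz⟩)
    · exact ⟨0, by simp, by simpa [dessin] using h⟩
    · exact ⟨1, by simp, by simpa [dessin] using h⟩
    · obtain ⟨t, ht, h⟩ := edge_subset he hz
      exact ⟨t, Set.Ioo_subset_Icc_self ht, h⟩
  · rintro ⟨t, ⟨h0, h1⟩, h⟩
    rcases h0.eq_or_lt with rfl | h0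
    · exact Or.inl (Or.inl (by simpa [dessin] using h))
    rcases h1.eq_or_lt with rfl | h1
    · exact Or.inl (Or.inr (by simpa [dessin] using h))
    obtain ⟨e, he, hz⟩ := exists_edge_mem (F := F) ⟨t, ⟨h0, h1⟩, h⟩
    exact Or.inr ⟨e, he, hz⟩

/-- As `‖F‖ < 1` on the circle, a nonnegative real value lies in `[0, 1]`, and its point belongs to
the dessin. -/
theorem IsSmallRadius.mem_posSlit {F : ℂ[X]} {v : ℂ} {r : ℝ} (h : IsSmallRadius F v r) {t : ℝ}
    (ht : circleMap v r t ∉ (dessin F).support) : F.eval (circleMap v r t) ∈ posSlit := by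
  by_contra hcon
  simp only [posSlit, Set.mem_ofPred_eq, not_or, not_not, not_lt] at hcon
  refine ht (mem_support_dessin.2 ⟨(F.eval (circleMap v r t)).re, ⟨hcon.2, ?_⟩, ?_⟩)
  · exact (Complex.re_le_norm _).trans (h t).2.1.le
  · exact Complex.ext (by simp) (by simp [hcon.1])

theorem IsSheet.eventually_circleMap {F : ℂ[X]} (hF : criticalValues F ⊆ {0, 1}) {e : Set ℂ}
    {s : ℂ → ℂ} (hs : IsSheet F e s) {v : ℂ} {r θ : ℝ} (hθ : circleMap v r θ ∈ e) :
    ∀ᶠ t in 𝓝 θ, s (F.eval (circleMap v r t)) = circleMap v r t := by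
  have h := hs.toIsBranch.eventually_apply_eval hF isOpen_doubleSlit doubleSlit_subset
    (eval_mem_doubleSlit (edge_subset hs.mem_edges hθ)) (hs.apply_eval hF hθ)
  filter_upwards [(continuous_circleMap v r).continuousAt.eventually h] with t ht using ht.2

/-- An arc of a small circle around a preimage of `0` that leads from `e` to `e'` outside the dessin
crosses from the sheet of `e` to the next one. -/
theorem IsSmallRadius.isTurn {F : ℂ[X]} (hF : criticalValues F ⊆ {0, 1}) {v : ℂ} {r : ℝ}
    (h : IsSmallRadius F v r) {e e' : Set ℂ} (he : e ∈ (dessin F).edges)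
    (he' : e' ∈ (dessin F).edges) {θ θ' : ℝ} (hlt : θ < θ') (hθ : circleMap v r θ ∈ e)
    (hθ' : circleMap v r θ' ∈ e')
    (harc : ∀ t ∈ Set.Ioo θ θ', circleMap v r t ∉ (dessin F).support) : IsTurn F e e' := by
  obtain ⟨s₁, h₁⟩ := exists_isSheet_of_mem_edge hF he
  obtain ⟨s₂, h₂⟩ := exists_isSheet_of_mem_edge hF he'
  obtain ⟨x, hx, hxe⟩ := edge_subset he hθ
  obtain ⟨x', hx', hxe'⟩ := edge_subset he' hθ'
  have hslit : ∀ t ∈ Set.Ioo θ θ', F.eval (circleMap v r t) ∈ posSlit :=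
    fun t ht => h.mem_posSlit (harc t ht)
  have hGT : ∀ᶠ t in 𝓝[>] θ, t ∈ Set.Ioo θ θ' := Ioo_mem_nhdsGT hlt
  have hLT : ∀ᶠ t in 𝓝[<] θ', t ∈ Set.Ioo θ θ' := Ioo_mem_nhdsLT hlt
  -- Just after `θ` the arc is still on the sheet of `e`, over the upper half plane; just before
  -- `θ'` it is on the sheet of `e'`, over the lower one. A single branch over `posSlit` follows the
  -- arc from `a` to `b`.
  obtain ⟨a, haθ, ha1, ha2⟩ := (hGT.and ((h.eventually_im hx.1 hxe).1.and
    (eventually_nhdsWithin_of_eventually_nhds (h₁.eventually_circleMap hF hθ)))).exists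
  obtain ⟨b, hbθ, hb1, hb2⟩ := (hLT.and ((h.eventually_im hx'.1 hxe').2.and
    (eventually_nhdsWithin_of_eventually_nhds (h₂.eventually_circleMap hF hθ')))).exists
  obtain ⟨s, hs, hsa⟩ := exists_isBranch hF isOpen_posSlit starConvex_posSlit posSlit_subset
    (hslit a haθ)
  have hsb : s (F.eval (circleMap v r b)) = circleMap v r b := by
    refine hs.apply_eval hF posSlit_subset
      (isPreconnected_Ioo.image _ (continuous_circleMap v r).continuousOn) ?_
      (Set.mem_image_of_mem _ haθ) hsa (Set.mem_image_of_mem _ hbθ)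
    rintro _ ⟨t, ht, rfl⟩
    exact hslit t ht
  refine ⟨s, s₁, s₂, hs, h₁, h₂, ?_, ?_⟩
  · exact (hs.mono upperHalf_subset_posSlit).eqOn hF
      (h₁.toIsBranch.mono upperHalf_subset_doubleSlit) isPreconnected_upperHalf
      (upperHalf_subset_posSlit.trans posSlit_subset) ha1 (hsa.trans ha2.symm)
  · exact (hs.mono lowerHalf_subset_posSlit).eqOn hF
      (h₂.toIsBranch.mono lowerHalf_subset_doubleSlit) isPreconnected_lowerHalf
      (lowerHalf_subset_posSlit.trans posSlit_subset) hb1 (hsb.trans hb2.symm)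

theorem isTurn_of_ccwNext {F : ℂ[X]} (hF : criticalValues F ⊆ {0, 1}) (hF0 : F ≠ 0) {v : ℂ}
    (hv : F.eval v = 0) {e e' : Set ℂ} (he : e ∈ (dessin F).edges) (he' : e' ∈ (dessin F).edges)
    (h : (dessin F).CcwNext v e e') : IsTurn F e e' := by
  obtain ⟨r, hr, θ, θ', hlt, -, hθ, hθ', harc⟩ :=
    ((eventually_isSmallRadius hF0 hv).and h).exists
  exact hr.isTurn hF he he' hlt hθ hθ' harc

/-- From a point of the dessin on a small circle, some arc leads to a next point of the dessin. -/
theorem IsSmallRadius.exists_next {F : ℂ[X]} {v : ℂ} {r : ℝ} (h : IsSmallRadius F v r)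
    {e : Set ℂ} (he : e ∈ (dessin F).edges) {θ : ℝ} (hθ : circleMap v r θ ∈ e) :
    ∃ e' ∈ (dessin F).edges, ∃ θ', θ < θ' ∧ θ' ≤ θ + 2 * Real.pi ∧ circleMap v r θ' ∈ e' ∧
      ∀ t ∈ Set.Ioo θ θ', circleMap v r t ∉ (dessin F).support := by
  obtain ⟨x, hx, hxe⟩ := edge_subset he hθ
  have hup := (h.eventually_im hx.1 hxe).1
  obtain ⟨δ, hδ, hδs⟩ := mem_nhdsGT_iff_exists_Ioo_subset.1 hup
  have hout : ∀ t ∈ Set.Ioo θ δ, circleMap v r t ∉ (dessin F).support := by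
    intro t ht hsupp
    obtain ⟨y, hy, hye⟩ := mem_support_dessin.1 hsupp
    have : 0 < (F.eval (circleMap v r t)).im := hδs ht
    rw [hye, Complex.ofReal_im] at this
    exact lt_irrefl _ this
  have hclosed : IsClosed {t : ℝ | circleMap v r t ∈ (dessin F).support} := by
    have : {t : ℝ | circleMap v r t ∈ (dessin F).support}
        = (fun t => F.eval (circleMap v r t)) ⁻¹' ((fun x : ℝ => (x : ℂ)) '' Set.Icc 0 1) := by
      ext t
      simp only [Set.mem_ofPred_eq, mem_support_dessin, Set.mem_preimage, Set.mem_image, eq_comm]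
    rw [this]
    exact ((isCompact_Icc.image Complex.continuous_ofReal).isClosed).preimage
      (F.continuous.comp (continuous_circleMap v r))
  have hper : circleMap v r (θ + 2 * Real.pi) = circleMap v r θ := periodic_circleMap v r θ
  have hsupp : circleMap v r (θ + 2 * Real.pi) ∈ (dessin F).support := by
    rw [hper]; exact Or.inr ⟨e, he, hθ⟩
  have hδle : δ ≤ θ + 2 * Real.pi := by
    by_contra hcon
    exact hout _ ⟨by linarith [Real.pi_pos], not_le.1 hcon⟩ hsupp
  -- The first return to the dessin. Starting the compact interval at `δ` excludes `θ` itself, and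
  -- the closing point `θ + 2π` makes the set nonempty.
  obtain ⟨θ', ⟨hθ'1, hθ'2⟩, hmin⟩ := (isCompact_Icc.inter_right hclosed).exists_isLeast
    (s := Set.Icc δ (θ + 2 * Real.pi) ∩ {t : ℝ | circleMap v r t ∈ (dessin F).support})
    ⟨_, ⟨hδle, le_rfl⟩, hsupp⟩
  obtain ⟨y, hy, hye⟩ := mem_support_dessin.1 hθ'2
  -- The value is nonzero and of modulus below `1`, so the point lies on an open edge and is not a
  -- vertex.
  have hy' : y ∈ Set.Ioo (0 : ℝ) 1 := by
    have h1 := h θ'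
    rw [hye] at h1
    refine ⟨lt_of_le_of_ne hy.1 fun h0 => h1.1 (by rw [← h0]; simp), ?_⟩
    have h2 := h1.2.1
    rw [Complex.norm_real, Real.norm_eq_abs] at h2
    exact (le_abs_self y).trans_lt h2
  obtain ⟨e', he', hmem⟩ := exists_edge_mem (F := F) ⟨y, hy', hye⟩
  refine ⟨e', he', θ', hδ.trans_le hθ'1.1, hθ'1.2, hmem, fun t ht hts => ?_⟩
  rcases lt_or_ge t δ with htδ | htδ
  · exact hout t ⟨ht.1, htδ⟩ hts
  · exact (hmin ⟨⟨htδ, ht.2.le.trans hθ'1.2⟩, hts⟩).not_gt ht.2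

/-- A connected edge with points arbitrarily close to `v` and a point `p ≠ v` meets every circle of
radius below `dist p v`, by the intermediate value theorem for the distance. -/
theorem eventually_circleMap_mem_edge {F : ℂ[X]} {e : Set ℂ} (he : e ∈ (dessin F).edges) {v : ℂ}
    (hv : F.eval v = 0) (hve : v ∈ closure e) :
    ∀ᶠ r in 𝓝[>] (0 : ℝ), ∃ θ : ℝ, circleMap v r θ ∈ e := by
  have hvne : v ∉ e := by
    intro h
    obtain ⟨t, ht, h⟩ := edge_subset he h
    rw [hv] at h
    exact ht.1.ne (by exact_mod_cast h)
  obtain ⟨p, hp⟩ : e.Nonempty := by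
    obtain ⟨z, hz, rfl⟩ := he
    exact ⟨z, mem_connectedComponentIn hz⟩
  have hpv : 0 < dist p v := dist_pos.2 fun h => hvne (h ▸ hp)
  filter_upwards [Ioo_mem_nhdsGT hpv] with r hr
  obtain ⟨q, hq, hqr⟩ := Metric.mem_closure_iff.1 hve r hr.1
  obtain ⟨y, hy, hyr⟩ := (edge_isPreconnected he).intermediate_value hq hp
    (f := fun y => dist y v) (continuous_id.dist continuous_const).continuousOn
    (show r ∈ Set.Icc _ _ from ⟨by rw [dist_comm]; exact hqr.le, hr.2.le⟩)
  have : y ∈ Metric.sphere v |r| := by rw [abs_of_pos hr.1]; exact hyr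
  rw [← range_circleMap] at this
  obtain ⟨θ, rfl⟩ := this
  exact ⟨θ, hy⟩

/-- Some next edge exists on each small circle, the arc to it yields a turn, and turns are unique.
-/
theorem ccwNext_of_isTurn {F : ℂ[X]} (hF : criticalValues F ⊆ {0, 1}) (hF0 : F ≠ 0) {v : ℂ}
    (hv : F.eval v = 0) {e e' : Set ℂ} (hve : v ∈ closure e) (h : IsTurn F e e') :
    (dessin F).CcwNext v e e' := by
  have he : e ∈ (dessin F).edges := by
    obtain ⟨s, s₁, s₂, -, h₁, -⟩ := h
    exact h₁.mem_edges
  filter_upwards [eventually_isSmallRadius hF0 hv, eventually_circleMap_mem_edge he hv hve]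
    with r hr ⟨θ, hθ⟩
  obtain ⟨e'', he'', θ', hlt, hle, hθ', harc⟩ := hr.exists_next he hθ
  have heq := (hr.isTurn hF he he'' hlt hθ hθ' harc).right_unique hF h
  exact ⟨θ, θ', hlt, hle, hθ, heq ▸ hθ', harc⟩

/-- Polynomial maps are closed, so the image of `closure e` is closed; it contains `(0, 1)` and
therefore `0`. -/
theorem exists_zero_mem_closure {F : ℂ[X]} (hF : criticalValues F ⊆ {0, 1}) {e : Set ℂ}
    (he : e ∈ (dessin F).edges) : ∃ v, F.eval v = 0 ∧ v ∈ closure e := by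
  obtain ⟨s, hs⟩ := exists_isSheet_of_mem_edge hF he
  have hsub : (fun x : ℝ => (x : ℂ)) '' Set.Ioo 0 1 ⊆ F.eval '' closure e := by
    rintro _ ⟨x, hx, rfl⟩
    exact ⟨s x, subset_closure (hs.mem_edge x hx), hs.eval_apply _ (ofReal_mem_doubleSlit hx)⟩
  have h0 : (0 : ℂ) ∈ closure ((fun x : ℝ => (x : ℂ)) '' Set.Ioo 0 1) := by
    refine image_closure_subset_closure_image Complex.continuous_ofReal ⟨0, ?_, by simp⟩
    rw [closure_Ioo zero_ne_one]
    simp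
  obtain ⟨v, hv, h⟩ := closure_minimal hsub (F.isClosedMap_eval _ isClosed_closure) h0
  exact ⟨v, h, hv⟩

/-! ### Exchanging the colors -/

/-- Passing to `1 - F` keeps the edges and the cyclic orders and turns white vertices into black
ones, so what holds around `0` transfers to `1`. -/
theorem criticalValues_one_sub {F : ℂ[X]} (hF : criticalValues F ⊆ {0, 1}) :
    criticalValues (1 - F) ⊆ {0, 1} := by
  rintro _ ⟨z, hz, rfl⟩
  have hz' : z ∈ criticalPoints F := by simpa [criticalPoints] using hz
  rcases hF ⟨z, hz', rfl⟩ with h | h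
  · right; simpa using h
  · left
    have h' : F.eval z = 1 := h
    simp [h']

theorem openSegmentPreimage_one_sub (F : ℂ[X]) :
    openSegmentPreimage (1 - F) = openSegmentPreimage F := by
  ext z
  constructor
  · rintro ⟨t, ht, h⟩
    refine ⟨1 - t, ⟨by linarith [ht.2], by linarith [ht.1]⟩, ?_⟩
    rw [Complex.ofReal_sub, ← h]; simp
  · rintro ⟨t, ht, h⟩
    refine ⟨1 - t, ⟨by linarith [ht.2], by linarith [ht.1]⟩, ?_⟩
    rw [Complex.ofReal_sub, ← h]; simp

theorem edges_one_sub (F : ℂ[X]) : (dessin (1 - F)).edges = (dessin F).edges := by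
  simp only [dessin, openSegmentPreimage_one_sub]

theorem support_one_sub (F : ℂ[X]) : (dessin (1 - F)).support = (dessin F).support := by
  ext z
  simp only [PlaneDrawing.support, edges_one_sub, Set.mem_union]
  have h1 : z ∈ (dessin (1 - F)).black ↔ z ∈ (dessin F).white := by
    change (1 - F).eval z = 0 ↔ F.eval z = 1
    rw [eval_sub, eval_one, sub_eq_zero, eq_comm]
  have h2 : z ∈ (dessin (1 - F)).white ↔ z ∈ (dessin F).black := by
    simp [dessin]
  rw [h1, h2, or_comm (a := z ∈ (dessin F).white)]

theorem ccwNext_one_sub {F : ℂ[X]} {v : ℂ} {e e' : Set ℂ} :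
    (dessin (1 - F)).CcwNext v e e' ↔ (dessin F).CcwNext v e e' := by
  simp only [PlaneDrawing.CcwNext, support_one_sub]

theorem IsSheet.of_one_sub {F : ℂ[X]} {e : Set ℂ} {s : ℂ → ℂ} (hs : IsSheet (1 - F) e s) :
    IsSheet F e (fun w => s (1 - w)) := by
  refine ⟨⟨?_, fun w hw => ?_⟩, by rw [← edges_one_sub]; exact hs.mem_edges, fun x hx => ?_⟩
  · exact hs.continuousOn.comp (continuous_const.sub continuous_id).continuousOn
      fun w hw => one_sub_mem_doubleSlit hw
  · have := hs.eval_apply _ (one_sub_mem_doubleSlit hw)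
    rw [eval_sub, eval_one] at this
    linear_combination -this
  · have := hs.mem_edge (1 - x) ⟨by linarith [hx.2], by linarith [hx.1]⟩
    simpa using this

/-! ### Gluing the sheets -/

/-- On each sheet of `F`, the map `φ` is the passage to the corresponding sheet of `G`. -/
def Intertwines (F G : ℂ[X]) (j : Set ℂ → Set ℂ) (φ : ℂ → ℂ) : Prop :=
  ∀ e s t, IsSheet F e s → IsSheet G (j e) t → ∀ w ∈ doubleSlit, φ (s w) = t w

theorem Intertwines.one_sub {F G : ℂ[X]} {j : Set ℂ → Set ℂ} {φ : ℂ → ℂ}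
    (h : Intertwines F G j φ) : Intertwines (1 - F) (1 - G) j φ := by
  intro e s t hs ht w hw
  simpa using h e _ _ hs.of_one_sub ht.of_one_sub (1 - w) (one_sub_mem_doubleSlit hw)

/-- Sheets are injective and those of distinct edges are disjoint, so a point determines its edge
and its parameter `w`, and the edge determines the sheet of `G`. -/
theorem exists_intertwines {F G : ℂ[X]} (hF : criticalValues F ⊆ {0, 1})
    (hG : criticalValues G ⊆ {0, 1}) (j : Set ℂ → Set ℂ) : ∃ φ, Intertwines F G j φ := by
  have key : ∀ y : ℂ, ∃ c : ℂ, ∀ e s t, IsSheet F e s → IsSheet G (j e) t →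
      ∀ w ∈ doubleSlit, s w = y → c = t w := by
    intro y
    by_cases h : ∃ e s t w, IsSheet F e s ∧ IsSheet G (j e) t ∧ w ∈ doubleSlit ∧ s w = y
    · obtain ⟨e, s, t, w, hs, ht, hw, hy⟩ := h
      refine ⟨t w, fun e' s' t' hs' ht' w' hw' hy' => ?_⟩
      have hww : w = w' := by
        rw [← hs.eval_apply w hw, ← hs'.eval_apply w' hw', hy, hy']
      subst hww
      obtain rfl := hs.edge_eq hF hs' hw (hy.trans hy'.symm)
      exact ht.eqOn hG ht' hw
    -- Points on no sheet get the arbitrary value `0`.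
    · exact ⟨0, fun e s t hs ht w hw hy => absurd ⟨e, s, t, w, hs, ht, hw, hy⟩ h⟩
  choose φ hφ using key
  exact ⟨φ, fun e s t hs ht w hw => hφ (s w) e s t hs ht w hw rfl⟩

/-- `φ`, defined on the preimage of the doubly slit plane, extends holomorphically near `z`. -/
def ExtendsAt (F : ℂ[X]) (φ : ℂ → ℂ) (z : ℂ) : Prop :=
  ∃ ψ : ℂ → ℂ, (∀ᶠ y in 𝓝 z, DifferentiableAt ℂ ψ y) ∧
    ∀ᶠ y in 𝓝 z, F.eval y ∈ doubleSlit → φ y = ψ y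

theorem IsBranch.eventually_differentiableAt_comp {F G : ℂ[X]} (hG : criticalValues G ⊆ {0, 1})
    {T : Set ℂ} {t : ℂ → ℂ} (ht : IsBranch G T t) (hT : IsOpen T) (hr : T ⊆ ({0, 1} : Set ℂ)ᶜ)
    {z : ℂ} (hz : F.eval z ∈ T) :
    ∀ᶠ y in 𝓝 z, DifferentiableAt ℂ (fun y => t (F.eval y)) y := by
  filter_upwards [(hT.preimage F.continuous).mem_nhds hz] with y hy
  exact (ht.differentiableAt hG hT hr hy).comp y F.differentiable.differentiableAt

theorem Intertwines.extendsAt_of_mem_doubleSlit {F G : ℂ[X]} (hF : criticalValues F ⊆ {0, 1})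
    (hG : criticalValues G ⊆ {0, 1}) {j : Set ℂ → Set ℂ}
    (hj : Set.MapsTo j (dessin F).edges (dessin G).edges) {φ : ℂ → ℂ} (hφ : Intertwines F G j φ)
    {z : ℂ} (hz : F.eval z ∈ doubleSlit) : ExtendsAt F φ z := by
  obtain ⟨s, hs, hsz⟩ := exists_isBranch hF isOpen_doubleSlit starConvex_doubleSlit
    doubleSlit_subset hz
  obtain ⟨e, he⟩ := hs.exists_isSheet
  obtain ⟨t, ht⟩ := exists_isSheet_of_mem_edge hG (hj he.mem_edges)
  refine ⟨fun y => t (F.eval y), ht.toIsBranch.eventually_differentiableAt_comp hG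
    isOpen_doubleSlit doubleSlit_subset hz, ?_⟩
  filter_upwards [hs.eventually_apply_eval hF isOpen_doubleSlit doubleSlit_subset hz hsz]
    with y hy _
  have := hφ e s t he ht _ hy.1
  rwa [hy.2] at this

/-- A branch of `F` over `posSlit` joins the sheets of `e` and `e'` across the negative reals;
compatibility with turns supplies a branch `t` of `G` joining the matching sheets, and `t ∘ F`
continues `φ` across the slit. -/
theorem Intertwines.extendsAt_of_mem_posSlit {F G : ℂ[X]} (hF : criticalValues F ⊆ {0, 1})
    (hG : criticalValues G ⊆ {0, 1}) {j : Set ℂ → Set ℂ}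
    (hj : ∀ e e', IsTurn F e e' → IsTurn G (j e) (j e')) {φ : ℂ → ℂ} (hφ : Intertwines F G j φ)
    {z : ℂ} (hz : F.eval z ∈ posSlit) : ExtendsAt F φ z := by
  obtain ⟨s, hs, hsz⟩ := exists_isBranch hF isOpen_posSlit starConvex_posSlit posSlit_subset hz
  obtain ⟨e, e', s₁, s₂, h₁, h₂, k₁, k₂⟩ := hs.exists_isTurn hF
  obtain ⟨t, t₁, t₂, ht, h₁', h₂', k₁', k₂'⟩ := hj e e' ⟨s, s₁, s₂, hs, h₁, h₂, k₁, k₂⟩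
  refine ⟨fun y => t (F.eval y),
    ht.eventually_differentiableAt_comp hG isOpen_posSlit posSlit_subset hz, ?_⟩
  filter_upwards [hs.eventually_apply_eval hF isOpen_posSlit posSlit_subset hz hsz] with y hy hyS
  have him : (F.eval y).im ≠ 0 := by
    intro h0
    rcases hyS with h | h
    · exact h h0
    · rcases hy.1 with h' | h'
      · exact h' h0
      · exact lt_asymm h.1 h'
  rcases lt_or_gt_of_ne him with him | him
  · have := hφ e' s₂ t₂ h₂ h₂' _ hyS
    rwa [← k₂ him, ← k₂' him, hy.2] at this
  · have := hφ e s₁ t₁ h₁ h₁' _ hyS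
    rwa [← k₁ him, ← k₁' him, hy.2] at this

theorem Intertwines.extendsAt {F G : ℂ[X]} (hF : criticalValues F ⊆ {0, 1})
    (hG : criticalValues G ⊆ {0, 1}) {j : Set ℂ → Set ℂ}
    (hj : Set.MapsTo j (dessin F).edges (dessin G).edges)
    (hj₀ : ∀ e e', IsTurn F e e' → IsTurn G (j e) (j e'))
    (hj₁ : ∀ e e', IsTurn (1 - F) e e' → IsTurn (1 - G) (j e) (j e'))
    {φ : ℂ → ℂ} (hφ : Intertwines F G j φ) {z : ℂ} (hz : F.eval z ∉ ({0, 1} : Set ℂ)) :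
    ExtendsAt F φ z := by
  rcases mem_slits_of_notMem_pair hz with h | h | h
  · exact hφ.extendsAt_of_mem_doubleSlit hF hG hj h
  · exact hφ.extendsAt_of_mem_posSlit hF hG hj₀ h
  · obtain ⟨ψ, h1, h2⟩ := hφ.one_sub.extendsAt_of_mem_posSlit (criticalValues_one_sub hF)
      (criticalValues_one_sub hG) hj₁ (z := z) (by simpa using h)
    refine ⟨ψ, h1, h2.mono fun y hy hyS => hy ?_⟩
    simpa using one_sub_mem_doubleSlit hyS

/-- Two local extensions agree on `V`, hence by continuity at the nearby points of `U`, as these are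
limits of points of `V`. So `z ↦ ψ z z` is locally one of the given extensions. -/
theorem exists_differentiableOn_extension {U V : Set ℂ} (hUV : U ⊆ closure V)
    (hU : IsOpen U) {φ : ℂ → ℂ}
    (h : ∀ z ∈ U, ∃ ψ : ℂ → ℂ, (∀ᶠ y in 𝓝 z, DifferentiableAt ℂ ψ y) ∧
      ∀ᶠ y in 𝓝 z, y ∈ V → φ y = ψ y) :
    ∃ Φ : ℂ → ℂ, DifferentiableOn ℂ Φ U ∧ Set.EqOn Φ φ (V ∩ U) := by
  choose! ψ hψd hψ using h
  refine ⟨fun z => ψ z z, fun z hz => ?_, fun z hz => ((hψ z hz.2).self_of_nhds hz.1).symm⟩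
  have heq : (fun y => ψ y y) =ᶠ[𝓝 z] ψ z := by
    filter_upwards [hU.mem_nhds hz, hψd z hz, (hψ z hz).eventually_nhds] with y hy hyd hyV
    have : (𝓝[V] y).NeBot := mem_closure_iff_nhdsWithin_neBot.1 (hUV hy)
    have h1 : Tendsto (ψ y) (𝓝[V] y) (𝓝 (ψ y y)) :=
      (hψd y hy).self_of_nhds.continuousAt.tendsto.mono_left nhdsWithin_le_nhds
    have h2 : Tendsto (ψ z) (𝓝[V] y) (𝓝 (ψ z y)) :=
      hyd.continuousAt.tendsto.mono_left nhdsWithin_le_nhds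
    refine tendsto_nhds_unique (h1.congr' ?_) h2
    filter_upwards [self_mem_nhdsWithin, nhdsWithin_le_nhds (hψ y hy), nhdsWithin_le_nhds hyV]
      with x hx hx1 hx2
    rw [← hx1 hx, ← hx2 hx]
  exact ((hψd z hz).self_of_nhds.congr_of_eventuallyEq heq).differentiableWithinAt

theorem dense_doubleSlit : Dense doubleSlit := by
  intro w
  by_cases hw : w.im = 0
  · refine Metric.mem_closure_iff.2 fun ε hε =>
      ⟨w + (ε / 2 : ℝ) * Complex.I, Or.inl (by simpa [hw] using hε.ne'), ?_⟩
    rw [dist_eq_norm]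
    simp only [sub_add_cancel_left, norm_neg, norm_mul, Complex.norm_real, Complex.norm_I, mul_one,
      Real.norm_eq_abs]
    rw [abs_of_pos (half_pos hε)]
    exact half_lt_self hε
  · exact subset_closure (Or.inl hw)

/-- At a noncritical point `F` maps neighbourhoods onto neighbourhoods, so density of the slit plane
pulls back. -/
theorem mem_closure_preimage_doubleSlit {F : ℂ[X]} (hF : criticalValues F ⊆ {0, 1}) {z : ℂ}
    (hz : F.eval z ∉ ({0, 1} : Set ℂ)) : z ∈ closure {y | F.eval y ∈ doubleSlit} := by
  have hmap := (F.hasStrictDerivAt z).map_nhds_eq (derivative_eval_ne_zero hF hz)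
  rw [mem_closure_iff_frequently]
  have := mem_closure_iff_frequently.1 (dense_doubleSlit (F.eval z))
  rw [← hmap, frequently_map] at this
  exact this

theorem finite_setOf_eval_mem_pair {F : ℂ[X]} (hFd : 0 < F.natDegree) :
    {z | F.eval z ∈ ({0, 1} : Set ℂ)}.Finite := by
  have h : ∀ c : ℂ, {z | F.eval z = c}.Finite := fun c => by
    refine ((F - C c).roots.toFinset.finite_toSet).subset fun z hz => ?_
    have hz' : F.eval z = c := hz
    simp [sub_C_ne_zero hFd c, hz']
  exact (h 0).union (h 1)

/-- Polynomials `F` and `G` of the same degree are affinely equivalent if `G ∘ Φ = F` for some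
entire function `Φ`. -/
theorem affineIso_of_eval_comp {F G : ℂ[X]} (hFd : 0 < F.natDegree)
    (hdeg : F.natDegree = G.natDegree) {Φ : ℂ → ℂ} (hΦ : Differentiable ℂ Φ)
    (h : ∀ z, G.eval (Φ z) = F.eval z) : AffineIso F G := by
  have hdF : (X ^ F.natDegree : ℂ[X]).degree = F.degree := by
    rw [degree_X_pow, degree_eq_natDegree (ne_zero_of_natDegree_gt hFd)]
  have hdG : (X ^ F.natDegree : ℂ[X]).degree = G.degree := by
    rw [degree_X_pow, hdeg, degree_eq_natDegree (ne_zero_of_natDegree_gt (hdeg ▸ hFd))]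
  have hprop : Tendsto F.eval (Bornology.cobounded ℂ) (Bornology.cobounded ℂ) :=
    tendsto_norm_atTop_iff_cobounded.1
      (F.tendsto_norm_atTop (natDegree_pos_iff_degree_pos.1 hFd) tendsto_norm_cobounded_atTop)
  -- `G` is bounded on bounded sets while `G ∘ Φ = F` tends to infinity, so `Φ` must tend to
  -- infinity.
  have htend : Tendsto Φ (Bornology.cobounded ℂ) (Bornology.cobounded ℂ) := by
    have hcomp : Tendsto (G.eval ∘ Φ) (Bornology.cobounded ℂ) (Bornology.cobounded ℂ) := by
      convert hprop using 1
      exact funext h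
    rw [Metric.cobounded_eq_cocompact] at hcomp ⊢
    exact hcomp.of_tendsto_comp (comap_cocompact_le G.continuous)
  -- With `n` the common degree, `Φ ^ n = O(G ∘ Φ) = O(F) = O(z ^ n)`.
  have hO : Φ =O[Bornology.cobounded ℂ] (fun z => z) := by
    have h1 := (isBigO_cobounded_of_degree_le hdG.le).comp_tendsto htend
    have h2 : (fun z => F.eval z) =O[Bornology.cobounded ℂ] _ := isBigO_cobounded_of_degree_le hdF.ge
    have h3 : (fun z => (Φ z) ^ F.natDegree) =O[Bornology.cobounded ℂ]
        (fun z => z ^ F.natDegree) := by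
      have h1' : (fun z => (Φ z) ^ F.natDegree) =O[Bornology.cobounded ℂ] (fun z => F.eval z) := by
        simpa [Function.comp_def, h] using h1
      have h2' : (fun z => F.eval z) =O[Bornology.cobounded ℂ] (fun z => z ^ F.natDegree) := by
        simpa using h2
      exact h1'.trans h2'
    exact h3.of_pow hFd.ne'
  -- The quotient `(Φ z - Φ 0) / z`, filled in at `0`, is entire and bounded, hence constant by
  -- Liouville.
  have hds : Differentiable ℂ (dslope Φ 0) := by
    rw [← differentiableOn_univ, Complex.differentiableOn_dslope univ_mem]
    exact hΦ.differentiableOn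
  have hbd : Bornology.IsBounded (Set.range (dslope Φ 0)) := by
    have hO1 : (dslope Φ 0) =O[Bornology.cobounded ℂ] (fun _ => (1 : ℂ)) := by
      have hO2 : (fun z => Φ z - Φ 0) =O[Bornology.cobounded ℂ] (fun z => z) :=
        hO.sub (Asymptotics.isLittleO_const_id_cobounded (Φ 0)).isBigO
      have hO3 := (Asymptotics.isBigO_refl (fun z : ℂ => z⁻¹) (Bornology.cobounded ℂ)).mul hO2
      have hne := Bornology.eventually_ne_cobounded (0 : ℂ)
      refine hO3.congr' ?_ ?_
      · filter_upwards [hne] with z hz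
        rw [dslope_of_ne _ hz, slope_def_module, sub_zero, smul_eq_mul]
      · filter_upwards [hne] with z hz
        rw [inv_mul_cancel₀ hz]
    obtain ⟨c, hc⟩ := hO1.bound
    have hB : Bornology.IsBounded {z | ‖dslope Φ 0 z‖ ≤ c * ‖(1 : ℂ)‖}ᶜ :=
      Bornology.isBounded_def.2 (by rwa [compl_compl])
    refine ((hB.isCompact_closure.image hds.continuous).isBounded.union
      (Metric.isBounded_closedBall (x := (0 : ℂ)) (r := c * ‖(1 : ℂ)‖))).subset ?_
    rintro _ ⟨z, rfl⟩
    by_cases hz : ‖dslope Φ 0 z‖ ≤ c * ‖(1 : ℂ)‖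
    · exact Or.inr (by simpa using hz)
    · exact Or.inl ⟨z, subset_closure hz, rfl⟩
  have hlin : ∀ z, Φ z = dslope Φ 0 0 * z + Φ 0 := by
    intro z
    rw [hds.apply_eq_apply_of_bounded hbd 0 z]
    have := sub_smul_dslope Φ 0 z
    rw [sub_zero, smul_eq_mul] at this
    linear_combination -this
  have hFG : F = G.comp (C (dslope Φ 0 0) * X + C (Φ 0)) := by
    refine Polynomial.funext fun z => ?_
    rw [← h z, hlin z]
    simp
  refine ⟨_, _, fun h0 => ?_, hFG⟩
  rw [h0, C_0, zero_mul, zero_add, comp_C] at hFG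
  rw [hFG, natDegree_C] at hFd
  exact lt_irrefl _ hFd

theorem Intertwines.eval_eq {F G : ℂ[X]} (hF : criticalValues F ⊆ {0, 1})
    (hG : criticalValues G ⊆ {0, 1}) {j : Set ℂ → Set ℂ}
    (hj : Set.MapsTo j (dessin F).edges (dessin G).edges) {φ : ℂ → ℂ} (hφ : Intertwines F G j φ)
    {z : ℂ} (hz : F.eval z ∈ doubleSlit) : G.eval (φ z) = F.eval z := by
  obtain ⟨s, hs, hsz⟩ := exists_isBranch hF isOpen_doubleSlit starConvex_doubleSlit
    doubleSlit_subset hz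
  obtain ⟨e, he⟩ := hs.exists_isSheet
  obtain ⟨t, ht⟩ := exists_isSheet_of_mem_edge hG (hj he.mem_edges)
  have := hφ e s t he ht _ hz
  rw [hsz] at this
  rw [this, ht.eval_apply _ hz]

/-- A bounded holomorphic lift on the complement of a finite fiber extends to an entire function. -/
theorem exists_entire_extension {F G : ℂ[X]} (hFd : 0 < F.natDegree) (hGd : 0 < G.natDegree)
    {Φ : ℂ → ℂ} (hΦ : DifferentiableOn ℂ Φ {z | F.eval z ∉ ({0, 1} : Set ℂ)})
    (h : ∀ z, F.eval z ∉ ({0, 1} : Set ℂ) → G.eval (Φ z) = F.eval z) :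
    ∃ Ψ : ℂ → ℂ, Differentiable ℂ Ψ ∧ ∀ z, G.eval (Ψ z) = F.eval z := by
  have hfin := finite_setOf_eval_mem_pair hFd
  have hUopen : IsOpen {z | F.eval z ∉ ({0, 1} : Set ℂ)} := hfin.isClosed.isOpen_compl
  have hUdense : Dense {z | F.eval z ∉ ({0, 1} : Set ℂ)} := hfin.countable.dense_compl ℝ
  obtain ⟨Ψ, hΨ, hΨΦ⟩ := exists_differentiableOn_extension (U := Set.univ) (φ := Φ)
    (fun z _ => hUdense z) isOpen_univ (fun z _ => by
      have hN : ∀ᶠ y in 𝓝 z, y ∉ {x | F.eval x ∈ ({0, 1} : Set ℂ)} \ {z} :=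
        (hfin.subset Set.sdiff_subset).isClosed.isOpen_compl.mem_nhds (fun h => h.2 rfl)
      obtain ⟨ε, hε, hball⟩ := Metric.eventually_nhds_iff_ball.1 hN
      have hsub : Metric.ball z ε \ {z} ⊆ {x | F.eval x ∉ ({0, 1} : Set ℂ)} :=
        fun y hy hy' => hball y hy.1 ⟨hy', hy.2⟩
      -- Near `z` the values of `Φ` lie in the `G`-preimage of a compact set, which is compact
      -- because `G` is proper; the singularity is removable.
      have hd := Complex.differentiableOn_update_limUnder_of_bddAbove
        (Metric.ball_mem_nhds z hε) (hΦ.mono hsub) (by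
          have hK : IsCompact (G.eval ⁻¹' (F.eval '' Metric.closedBall z ε)) :=
            (G.isProperMap_eval (natDegree_pos_iff_degree_pos.1 hGd)).isCompact_preimage
              ((isCompact_closedBall z ε).image F.continuous)
          obtain ⟨R, hR⟩ := hK.isBounded.exists_norm_le
          refine ⟨R, ?_⟩
          rintro _ ⟨y, hy, rfl⟩
          refine hR _ ⟨y, Metric.ball_subset_closedBall hy.1, ?_⟩
          exact (h y (hsub hy)).symm)
      refine ⟨Function.update Φ z (limUnder (𝓝[≠] z) Φ), ?_, ?_⟩
      · filter_upwards [Metric.ball_mem_nhds z hε] with y hy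
        exact hd.differentiableAt (Metric.isOpen_ball.mem_nhds hy)
      · by_cases hz : F.eval z ∈ ({0, 1} : Set ℂ)
        · refine Eventually.of_forall fun y hy => ?_
          rw [Function.update_of_ne]
          rintro rfl
          exact hy hz
        · have hc : Tendsto Φ (𝓝[≠] z) (𝓝 (Φ z)) :=
            ((hΦ.differentiableAt (hUopen.mem_nhds hz)).continuousAt).tendsto.mono_left
              nhdsWithin_le_nhds
          rw [hc.limUnder_eq, Function.update_eq_self]
          exact Eventually.of_forall fun y _ => rfl)
  have hΨ' : Differentiable ℂ Ψ := differentiableOn_univ.1 hΨ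
  refine ⟨Ψ, hΨ', fun z => ?_⟩
  refine congrFun (Continuous.ext_on hUdense (G.continuous.comp hΨ'.continuous) F.continuous
    fun y hy => ?_) z
  change G.eval (Ψ y) = F.eval y
  rw [hΨΦ ⟨hy, Set.mem_univ y⟩, h y hy]

/-- Polynomials of the same degree with critical values `0` and `1` are isomorphic if their edges
are matched compatibly with the monodromy around `0` and around `1`. -/
theorem affineIso_of_isTurn {F G : ℂ[X]} (hF : criticalValues F ⊆ {0, 1})
    (hG : criticalValues G ⊆ {0, 1}) (hFd : 0 < F.natDegree) (hdeg : F.natDegree = G.natDegree)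
    {j : Set ℂ → Set ℂ} (hj : Set.MapsTo j (dessin F).edges (dessin G).edges)
    (hj₀ : ∀ e e', IsTurn F e e' → IsTurn G (j e) (j e'))
    (hj₁ : ∀ e e', IsTurn (1 - F) e e' → IsTurn (1 - G) (j e) (j e')) : AffineIso F G := by
  obtain ⟨φ, hφ⟩ := exists_intertwines hF hG j
  have hUopen : IsOpen {z | F.eval z ∉ ({0, 1} : Set ℂ)} :=
    (finite_setOf_eval_mem_pair hFd).isClosed.isOpen_compl
  obtain ⟨Φ, hΦ, hΦφ⟩ := exists_differentiableOn_extension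
    (U := {z | F.eval z ∉ ({0, 1} : Set ℂ)}) (V := {y | F.eval y ∈ doubleSlit}) (φ := φ)
    (fun z hz => mem_closure_preimage_doubleSlit hF hz) hUopen
    (fun z hz => hφ.extendsAt hF hG hj hj₀ hj₁ hz)
  have hlift : ∀ z, F.eval z ∉ ({0, 1} : Set ℂ) → G.eval (Φ z) = F.eval z := by
    intro z hz
    have : (𝓝[{y | F.eval y ∈ doubleSlit}] z).NeBot :=
      mem_closure_iff_nhdsWithin_neBot.1 (mem_closure_preimage_doubleSlit hF hz)
    have hc : ContinuousAt (fun y => G.eval (Φ y)) z := G.continuous.continuousAt.comp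
      (hΦ.differentiableAt (hUopen.mem_nhds hz)).continuousAt
    -- The identity `G ∘ Φ = F` holds on the sheets and passes to limits across the slits.
    refine tendsto_nhds_unique_of_eventuallyEq (l := 𝓝[{y | F.eval y ∈ doubleSlit}] z)
      (hc.tendsto.mono_left nhdsWithin_le_nhds)
      (F.continuous.continuousAt.tendsto.mono_left nhdsWithin_le_nhds) ?_
    filter_upwards [self_mem_nhdsWithin] with y hy
    rw [hΦφ ⟨hy, doubleSlit_subset hy⟩]
    exact hφ.eval_eq hF hG hj hy
  obtain ⟨Ψ, hΨ, hΨF⟩ := exists_entire_extension hFd (hdeg ▸ hFd) hΦ hlift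
  exact affineIso_of_eval_comp hFd hdeg hΨ hΨF

/-! ### Isomorphic dessins come from isomorphic polynomials -/

/-- Each edge contains exactly one preimage of the regular value `1/2`. -/
theorem ncard_edges_eq_natDegree {F : ℂ[X]} (hF : criticalValues F ⊆ {0, 1})
    (hFd : 0 < F.natDegree) : (dessin F).edges.ncard = F.natDegree := by
  set c : ℂ := ((1 / 2 : ℝ) : ℂ) with hc
  have hcS : c ∈ doubleSlit := ofReal_mem_doubleSlit half_mem_Ioo
  have hne := sub_C_ne_zero hFd c
  have hmem : ∀ z, z ∈ (F - C c).roots.toFinset ↔ F.eval z = c := by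
    intro z
    simp [hne, sub_eq_zero]
  have hnodup : (F - C c).roots.Nodup := by
    refine Multiset.nodup_iff_count_le_one.2 fun z => ?_
    rw [count_roots]
    by_contra hlt
    have h := (one_lt_rootMultiplicity_iff_isRoot hne).1 (not_le.1 hlt)
    have hz : F.eval z = c := by simpa [sub_eq_zero] using h.1
    refine derivative_eval_ne_zero hF (z := z) (hz ▸ doubleSlit_subset hcS) ?_
    simpa using h.2
  have hcard : (F - C c).roots.toFinset.card = F.natDegree := by
    rw [Multiset.toFinset_card_of_nodup hnodup,
      ← (IsAlgClosed.splits (F - C c)).natDegree_eq_card_roots, natDegree_sub_C]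
  rw [← hcard, ← Set.ncard_coe_finset]
  symm
  refine Set.ncard_congr (fun z _ => connectedComponentIn (openSegmentPreimage F) z) ?_ ?_ ?_
  · intro z hz
    exact ⟨z, ⟨_, half_mem_Ioo, (hmem z).1 hz⟩, rfl⟩
  · intro z z' hz hz' h
    have hz := (hmem z).1 hz
    have hz' := (hmem z').1 hz'
    have hzo : z ∈ openSegmentPreimage F := ⟨_, half_mem_Ioo, hz⟩
    have hzo' : z' ∈ openSegmentPreimage F := ⟨_, half_mem_Ioo, hz'⟩
    obtain ⟨s, hs⟩ := exists_isSheet_of_mem_edge hF (e := _) ⟨z, hzo, rfl⟩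
    have h1 := hs.apply_eval hF (mem_connectedComponentIn hzo)
    have h2 := hs.apply_eval hF (z := z') (by
      rw [h]
      exact mem_connectedComponentIn hzo')
    rw [← h1, ← h2, hz, hz']
  · intro e he
    obtain ⟨s, hs⟩ := exists_isSheet_of_mem_edge hF he
    have hsc : F.eval (s c) = c := hs.eval_apply _ hcS
    refine ⟨s c, (hmem _).2 hsc, ?_⟩
    have hso : s c ∈ openSegmentPreimage F := ⟨_, half_mem_Ioo, hsc⟩
    exact edge_eq_of_mem ⟨s c, hso, rfl⟩ he (mem_connectedComponentIn hso)
      (hs.mem_edge _ half_mem_Ioo)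

/-- A turn is read as cyclic order at a black end of `e`, carried over to `G`, and read back as a
turn. -/
theorem isTurn_map {F G : ℂ[X]} (hF : criticalValues F ⊆ {0, 1})
    (hG : criticalValues G ⊆ {0, 1}) (hF0 : F ≠ 0) (hG0 : G ≠ 0) {j : Set ℂ → Set ℂ}
    (hj : Set.MapsTo j (dessin F).edges (dessin G).edges)
    (hccw : ∀ v, F.eval v = 0 → ∃ v', G.eval v' = 0 ∧ ∀ e ∈ (dessin F).edges,
      ∀ e' ∈ (dessin F).edges, (dessin F).CcwNext v e e' → (dessin G).CcwNext v' (j e) (j e'))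
    {e e' : Set ℂ} (h : IsTurn F e e') : IsTurn G (j e) (j e') := by
  have hmem := h
  obtain ⟨_, _, _, -, h₁, h₂, -⟩ := hmem
  obtain ⟨v, hv, hve⟩ := exists_zero_mem_closure hF h₁.mem_edges
  obtain ⟨v', hv', hvv'⟩ := hccw v hv
  exact isTurn_of_ccwNext hG hG0 hv' (hj h₁.mem_edges) (hj h₂.mem_edges)
    (hvv' e h₁.mem_edges e' h₂.mem_edges (ccwNext_of_isTurn hF hF0 hv hve h))

theorem affineIso_of_isomorphic {F G : ℂ[X]} (hF : criticalValues F ⊆ {0, 1})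
    (hG : criticalValues G ⊆ {0, 1}) (hFd : 0 < F.natDegree) (hGd : 0 < G.natDegree)
    (h : (dessin F).Isomorphic (dessin G)) : AffineIso F G := by
  obtain ⟨i⟩ := h
  classical
  have hdeg : F.natDegree = G.natDegree := by
    rw [← ncard_edges_eq_natDegree hF hFd, ← ncard_edges_eq_natDegree hG hGd]
    exact Nat.card_congr i.onEdges
  -- The edge bijection as a map on all sets; its value off the edges is arbitrary.
  let j : Set ℂ → Set ℂ := fun e =>
    if he : e ∈ (dessin F).edges then (i.onEdges ⟨e, he⟩ : Set ℂ) else e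
  have hj_apply : ∀ e (he : e ∈ (dessin F).edges), j e = i.onEdges ⟨e, he⟩ :=
    fun e he => dif_pos he
  have hj : Set.MapsTo j (dessin F).edges (dessin G).edges := fun e he => by
    rw [hj_apply e he]
    exact (i.onEdges ⟨e, he⟩).2
  have hone : ∀ P : ℂ[X], 0 < P.natDegree → 1 - P ≠ 0 := fun P hP h0 => by
    rw [← sub_eq_zero.1 h0, natDegree_one] at hP
    exact lt_irrefl _ hP
  refine affineIso_of_isTurn hF hG hFd hdeg hj (fun e e' he => ?_) (fun e e' he => ?_)
  · refine isTurn_map hF hG (ne_zero_of_natDegree_gt hFd) (ne_zero_of_natDegree_gt hGd) hj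
      (fun v hv => ⟨i.onBlack ⟨v, hv⟩, (i.onBlack ⟨v, hv⟩).2, fun e he e' he' hn => ?_⟩) he
    rw [hj_apply e he, hj_apply e' he']
    exact (i.ccw_black ⟨v, hv⟩ ⟨e, he⟩ ⟨e', he'⟩).1 hn
  -- White vertices of `F` are the black vertices of `1 - F`.
  · refine isTurn_map (criticalValues_one_sub hF) (criticalValues_one_sub hG) (hone F hFd)
      (hone G hGd) (by rwa [edges_one_sub, edges_one_sub]) (fun v hv => ?_) he
    have hv1 : v ∈ (dessin F).white := by
      rw [eval_sub, eval_one, sub_eq_zero] at hv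
      exact hv.symm
    have hw : G.eval (i.onWhite ⟨v, hv1⟩ : ℂ) = 1 := (i.onWhite ⟨v, hv1⟩).2
    refine ⟨i.onWhite ⟨v, hv1⟩, by rw [eval_sub, eval_one, hw, sub_self],
      fun e he e' he' hn => ?_⟩
    rw [edges_one_sub] at he he'
    rw [ccwNext_one_sub] at hn ⊢
    rw [hj_apply e he, hj_apply e' he']
    exact (i.ccw_white ⟨v, hv1⟩ ⟨e, he⟩ ⟨e', he'⟩).1 hn

theorem PlaneDrawing.Isomorphic.refl (D : PlaneDrawing) : D.Isomorphic D :=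
  ⟨⟨Equiv.refl _, Equiv.refl _, Equiv.refl _, fun _ _ => Iff.rfl, fun _ _ => Iff.rfl,
    fun _ _ _ => Iff.rfl, fun _ _ _ => Iff.rfl⟩⟩

end BelyiDessin

theorem theorem3p4 :
    ∃ hcomp : ∀ f g : Polynomial ℂ, BelyiDessin.IsExtraClean f → BelyiDessin.IsExtraClean g →
        BelyiDessin.IsExtraClean (f.comp g),
      (∀ f g : Polynomial ℂ, BelyiDessin.IsExtraClean f → BelyiDessin.IsExtraClean g →
        ((BelyiDessin.dessin (f.comp f)).Isomorphic (BelyiDessin.dessin (g.comp g)) ↔ f = g)) ∧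
      Function.Injective (BelyiDessin.secondIterateClass hcomp) ∧
      ∀ (σ : BelyiDessin.AbsGal) (f : BelyiDessin.XDBP),
        BelyiDessin.secondIterateClass hcomp (σ • f) =
          σ • BelyiDessin.secondIterateClass hcomp f := by
  refine ⟨fun f g hf hg => hf.comp hg, fun f g hf hg => ⟨fun h => ?_, ?_⟩, fun f g h => ?_,
    fun σ f => ?_⟩
  · have hff := (hf.comp hf).toIsBelyi
    have hgg := (hg.comp hg).toIsBelyi
    exact hf.eq_of_affineIso hg (BelyiDessin.affineIso_of_isomorphic hff.criticalValues_subset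
      hgg.criticalValues_subset hff.natDegree_pos hgg.natDegree_pos h)
  · rintro rfl
    exact BelyiDessin.PlaneDrawing.Isomorphic.refl _
  -- Equality of classes is affine equivalence of the second iterates, so the algebraic half applies
  -- directly.
  · have hiso : BelyiDessin.AffineIso (BelyiDessin.toC (f.1.comp f.1))
        (BelyiDessin.toC (g.1.comp g.1)) := Quotient.exact h
    rw [BelyiDessin.toC_comp, BelyiDessin.toC_comp] at hiso
    exact Subtype.ext (BelyiDessin.toC_injective (f.2.eq_of_affineIso g.2 hiso))
  · exact congrArg (Quotient.mk BelyiDessin.bpSetoid)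
      (Subtype.ext (BelyiDessin.twist_comp σ f.1 f.1).symm)
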